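/- **Setting.** Let $z_1,\dots,z_N\in\mathbb C^+$ be distinct, let $c_1,\dots,c_N\in\mathbb C\setminus\{0\}$, and put $\theta(z;x,t)=xz+tz^2$. The $N$-soliton solution $\psi_N$ of the focusing NLS equation $\mathrm i\psi_t+\tfrac12\psi_{xx}+|\psi|^2\psi=0$ with reflectionless scattering data $\{(z_k,c_k)\}_{k=1}^N$ is given by $$\psi_N(x,t)=\lim_{z\to\infty}2\mathrm i z\,[M(z;x,t)]_{12},\qquad (x,t)\in\mathbb R^2,$$ where $M(\cdot\,;x,t)$ solves the following Riemann–Hilbert problem: $M$ is $\mathrm{SL}(2,\mathbb C)$-valued and analytic in $\mathbb C\setminus\{z_k,\overline z_k\}_{k=1}^N$; $M(z)=I+O(z^{-1})$ as $z\to\infty$; and $M$ has simple poles at the points $z_k,\overline z_k$ with $$\operatorname*{Res}_{z=z_k}M=c_k e^{2\mathrm i\theta(z_k;x,t)}\lim_{z\to z_k}M(z)\begin{pmatrix}0&0\\1&0\end{pmatrix},\qquad \operatorname*{Res}_{z=\overline z_k}M=-\overline{c_k}\,e^{-2\mathrm i\theta(\overline z_k;x,t)}\lim_{z\to\overline z_k}M(z)\begin{pmatrix}0&1\\0&0\end{pmatrix}.$$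 **Statement.** There are $C_*>0$ and $N_0\in\mathbb N$ such that for all $\alpha\in\mathbb R$, $\mu>0$ and every $R$ there is a constant $K=K(\alpha,\mu,R)$ with the following property. Let $N\ge N_0$, $V>0$, and let $$v_k\in[(\alpha N+k-1)V,(\alpha N+k)V],\qquad z_k=\tfrac12(-v_k+\mathrm i\mu),\qquad c_k=\mathrm i\mu\, e^{-2\mathrm i z_k^2}\qquad(k=1,\dots,N),$$ and suppose that $\Delta:=\min_{j\ne k}|v_j-v_k|$ satisfies $\Delta>C_*\mu$. Then the $N$-soliton solution $\psi_N$ with data $\{(z_k,c_k)\}_{k=1}^N$ exists and is unique, and for all real $X,T$ with $|X|,|T|\le R$ $$\left|\frac1N\psi_N\!\left(\frac{2X}{NV},\,1+\frac{T}{(NV)^2}\right)-\mu\,e^{\mathrm i(2\alpha X-\alpha^2T/2)}\,\psi_0\!\left(X-\frac{\alpha T}2,\,T\right)\right|\le K\max\left\{\frac1N,\frac1\Delta\right\},$$ where $$\psi_0(X,T)=-\int_0^1 e^{\mathrm i(2Xs-\frac T2s^2)}\,\mathrm ds .$$ In particular, at $T=0$, for $|X|\le R$, $$\left|\frac1N\psi_N\!\left(\frac{2X}{NV},1\right)+\mu\,e^{\mathrm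 i(2\alpha+1)X}\,\frac{\sin X}{X}\right|\le K\max\left\{\frac1N,\frac1\Delta\right\},$$ with $\frac{\sin X}{X}$ read as $1$ at $X=0$. -/

import Mathlib

open Complex Filter Topology

/-- The exponent `θ(z; x, t) = x z + t z²` of the focusing nonlinear Schrödinger equation
`i ψ_t + ψ_xx / 2 + |ψ|² ψ = 0`. -/
noncomputable def nlsPhase (z : ℂ) (x t : ℝ) : ℂ := x * z + t * z ^ 2

/-- `M` solves the reflectionless Riemann-Hilbert problem of the focusing nonlinear Schrödinger
equation at the point `(x, t)`, for the scattering data `(z_k, c_k)`, `k = 1, …, N`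
(poles `z_k` in the upper half plane and residue coefficients `c_k ≠ 0`).
The values of `M` at the poles `z_k` and `conj z_k` play no role. -/
structure SolvesSolitonRHP {N : ℕ} (z c : Fin N → ℂ) (x t : ℝ)
    (M : ℂ → Matrix (Fin 2) (Fin 2) ℂ) : Prop where
  /-- `M` is analytic away from the points `z_k` and `conj z_k`. -/
  analytic : ∀ i j, DifferentiableOn ℂ (fun w => M w i j)
    {w | ∀ k, w ≠ z k ∧ w ≠ (starRingEnd ℂ) (z k)}
  /-- `M` takes its values in `SL(2, ℂ)`. -/
  det_eq_one : ∀ w, (∀ k, w ≠ z k ∧ w ≠ (starRingEnd ℂ) (z k)) → (M w).det = 1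
  /-- `M(w) = I + O(1/w)` as `w → ∞`. -/
  normalized : ∀ i j, (fun w => M w i j - (1 : Matrix (Fin 2) (Fin 2) ℂ) i j)
    =O[Bornology.cobounded ℂ] (fun w => w⁻¹)
  /-- `M` has a simple pole at `z_k`, whose residue is the limit at `z_k` of `M` times a
  strictly lower triangular matrix. -/
  residue : ∀ k, ∃ L : Matrix (Fin 2) (Fin 2) ℂ,
    Tendsto (fun w => (w - z k) • M w) (𝓝[≠] (z k)) (𝓝 L) ∧
    Tendsto (fun w => M w * !![0, 0; c k * exp (2 * I * nlsPhase (z k) x t), 0])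
      (𝓝[≠] (z k)) (𝓝 L)
  /-- `M` has a simple pole at `conj z_k`, whose residue is the limit at `conj z_k` of `M` times a
  strictly upper triangular matrix. -/
  residue_conj : ∀ k, ∃ L : Matrix (Fin 2) (Fin 2) ℂ,
    Tendsto (fun w => (w - (starRingEnd ℂ) (z k)) • M w) (𝓝[≠] ((starRingEnd ℂ) (z k))) (𝓝 L) ∧
    Tendsto (fun w => M w * !![0, -((starRingEnd ℂ) (c k) *
        exp (-2 * I * nlsPhase ((starRingEnd ℂ) (z k)) x t)); 0, 0])
      (𝓝[≠] ((starRingEnd ℂ) (z k))) (𝓝 L)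

/-- `ψ` is the `N`-soliton solution of the focusing nonlinear Schrödinger equation with
reflectionless scattering data `(z_k, c_k)`: at each `(x, t)` it is recovered from the solution `M`
of the Riemann-Hilbert problem as `ψ(x, t) = lim_{w → ∞} 2 i w M₁₂(w; x, t)`. -/
def IsNSolitonSolution {N : ℕ} (z c : Fin N → ℂ) (ψ : ℝ → ℝ → ℂ) : Prop :=
  ∀ x t : ℝ, ∃ M : ℂ → Matrix (Fin 2) (Fin 2) ℂ, SolvesSolitonRHP z c x t M ∧
    Tendsto (fun w => 2 * I * w * M w 0 1) (Bornology.cobounded ℂ) (𝓝 (ψ x t))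

/-- The spectral point `z = (-v + i μ) / 2` of a soliton of amplitude `μ` and velocity `v`. -/
noncomputable def solitonPole (μ v : ℝ) : ℂ := (-(v : ℂ) + I * (μ : ℂ)) / 2

/-- The coefficient `c = i μ exp(-2 i z²)`, for which the soliton of amplitude `μ` and velocity `v`
passes through the space-time point `(0, 1)`. -/
noncomputable def collisionCoeff (μ v : ℝ) : ℂ :=
  I * (μ : ℂ) * exp (-2 * I * solitonPole μ v ^ 2)

/-- The Fresnel-type profile `ψ₀(X, T) = -∫₀¹ exp(i (2 X s - T s² / 2)) ds`. -/
noncomputable def fresnelProfile (X T : ℝ) : ℂ :=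
  -∫ s in (0 : ℝ)..1, exp (I * ((2 * X * s - T / 2 * s ^ 2 : ℝ) : ℂ))

-- By Liouville's theorem the first row of `M` is the sum of its partial fractions, so the
-- Riemann–Hilbert problem reduces to a finite linear system for the values a_j = M₁₁(conj z_j) and
-- b_j = M₁₂(z_j). All poles have height μ/2, hence the Cauchy matrix 1/(z_j - conj z_k) equals
-- -(i/μ)(1 + E), where E (`interactionMatrix`) has zero diagonal. Write μ g_k for the conjugate
-- residue coefficients and G = diag(g). Eliminating b leaves (1 + (1 + conj E) G* (1 + E) G) a = 1,
-- and ψ = -2iμ Σ g_k a_k.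
--
-- In the collision window the factor exp(-2iz²) of c_k removes the phase at t = 1, so that g_k = -i
-- exp(i(2X s_k - T s_k²/2)) (1 + O(1/N)), with s_k = v_k/(NV) lying in the k-th of N equal cells of
-- [α, α + 1]. If E were 0 and |g_k| were 1, every a_k would be 1/2, and ψ/N would be -μ times a
-- Riemann sum over [α, α + 1]; the substitution s = α + r turns its limit into the stated profile.
--
-- Two estimates make this rigorous. First, ‖E‖ ≤ 10 μ/Δ on ℓ², uniformly in N
-- (`interactionMatrix_bound`). Absolute row sums of E would lose a factor log N, so the principal
-- part 1/(v_k - v_l) is treated by Hilbert's inequality (`hilbert_inequality`) and only the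
-- absolutely summable remainder by Schur's test. Second, the system is stable for every g
-- (`norm_le_of_accretive`), because G*(1 + E)G has nonnegative real part. This gives existence and
-- uniqueness at all (x, t), and it bounds the distance of a from 1/2 (`norm_sum_sub_half_le`).

local notation "conj" => starRingEnd ℂ

/-! ### Liouville's theorem with removable singularities. -/

/-- A function which is analytic off a finite set, has no poles there, and vanishes at infinity is
zero off that set. -/
theorem eq_zero_of_removable_of_tendsto_zero (S : Finset ℂ) :
    ∀ f : ℂ → ℂ, DifferentiableOn ℂ f (S : Set ℂ)ᶜ →
      (∀ s ∈ S, Tendsto (fun w => (w - s) * f w) (𝓝[≠] s) (𝓝 0)) →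
      Tendsto f (Bornology.cobounded ℂ) (𝓝 0) → ∀ w ∉ S, f w = 0 := by
  classical
  induction S using Finset.induction_on with
  | empty =>
    intro f hf _ hinf w _
    have hd : Differentiable ℂ f := by
      intro w
      exact (hf w (by simp)).differentiableAt (by simp)
    exact hd.apply_eq_of_tendsto_cocompact w (by rwa [← Metric.cobounded_eq_cocompact])
  | insert s S hs ih =>
    intro f hf hpole hinf w hw
    have hopen : IsOpen ((S : Set ℂ)ᶜ) := S.finite_toSet.isClosed.isOpen_compl
    have hmem : (S : Set ℂ)ᶜ ∈ 𝓝 s := hopen.mem_nhds (by simpa using hs)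
    -- Riemann's theorem needs f(w) - f(s) = o((w - s)⁻¹). The value `f s` is arbitrary and
    -- contributes a term tending to 0. The updated function is analytic at s, which leaves one
    -- singularity fewer.
    have hdiff := Complex.differentiableOn_update_limUnder_of_isLittleO (f := f) hmem
      (hf.mono (by intro x hx; simp at hx ⊢; tauto)) (by
        have h1 := hpole s (Finset.mem_insert_self _ _)
        have h2 : Tendsto (fun w => (w - s) * f s) (𝓝[≠] s) (𝓝 0) := by
          have : Tendsto (fun w => (w - s) * f s) (𝓝 s) (𝓝 ((s - s) * f s)) :=
            ((continuous_id.sub continuous_const).mul continuous_const).tendsto s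
          simpa using this.mono_left nhdsWithin_le_nhds
        have h3 := h1.sub h2
        rw [Asymptotics.isLittleO_iff_tendsto' ?_]
        · refine Tendsto.congr (fun w => ?_) (by simpa using h3)
          rw [div_inv_eq_mul]; ring
        · filter_upwards [self_mem_nhdsWithin] with w hw h
          exact absurd (sub_eq_zero.1 (inv_eq_zero.1 h)) hw)
    set g := Function.update f s (limUnder (𝓝[≠] s) f) with hg
    have hgf : ∀ w, w ≠ s → g w = f w := fun w hw => Function.update_of_ne hw _ _
    have hws : w ≠ s := fun h => hw (by simp [h])
    rw [← hgf w hws]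
    refine ih g hdiff (fun r hr => ?_) ?_ w (fun h => hw (by simp [h]))
    · refine (hpole r (Finset.mem_insert_of_mem hr)).congr' ?_
      have hrs : r ≠ s := fun h => hs (h ▸ hr)
      filter_upwards [nhdsWithin_le_nhds (isOpen_ne.mem_nhds hrs)] with w hw
      rw [hgf w hw]
    · refine hinf.congr' ?_
      filter_upwards [Bornology.isBounded_singleton (x := s)] with w hw
      exact (hgf w hw).symm

/-! ### Partial fractions with simple poles. -/

section PoleSum

variable {ι : Type*} [Fintype ι]

/-- The rational function with simple poles `p k` and residues `r k`, vanishing at infinity. -/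
noncomputable def poleSum (p r : ι → ℂ) (w : ℂ) : ℂ := ∑ k, r k / (w - p k)

theorem poleSum_differentiableAt (p r : ι → ℂ) {w : ℂ} (hw : ∀ k, w ≠ p k) :
    DifferentiableAt ℂ (poleSum p r) w := by
  unfold poleSum
  refine DifferentiableAt.fun_sum fun k _ => ?_
  exact (differentiableAt_const _).div (by fun_prop) (sub_ne_zero.2 (hw k))

theorem poleSum_tendsto (p r : ι → ℂ) {s : ℂ} (hs : ∀ k, s ≠ p k) :
    Tendsto (poleSum p r) (𝓝[≠] s) (𝓝 (poleSum p r s)) :=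
  (poleSum_differentiableAt p r hs).continuousAt.tendsto.mono_left nhdsWithin_le_nhds

theorem tendsto_sub_nhdsNE (s : ℂ) : Tendsto (fun w => w - s) (𝓝[≠] s) (𝓝 0) := by
  have : Tendsto (fun w => w - s) (𝓝 s) (𝓝 (s - s)) :=
    (continuous_id.sub continuous_const).tendsto s
  simpa using this.mono_left nhdsWithin_le_nhds

theorem sub_mul_tendsto_zero {f : ℂ → ℂ} {s l : ℂ} (hf : Tendsto f (𝓝[≠] s) (𝓝 l)) :
    Tendsto (fun w => (w - s) * f w) (𝓝[≠] s) (𝓝 0) := by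
  simpa using (tendsto_sub_nhdsNE s).mul hf

theorem poleSum_residue (p r : ι → ℂ) (hp : Function.Injective p) (j : ι) :
    Tendsto (fun w => (w - p j) * poleSum p r w) (𝓝[≠] (p j)) (𝓝 (r j)) := by
  classical
  have key : ∀ k, Tendsto (fun w => (w - p j) * (r k / (w - p k))) (𝓝[≠] (p j))
      (𝓝 (if k = j then r j else 0)) := by
    intro k
    split_ifs with h
    · subst h
      refine tendsto_const_nhds.congr' ?_
      filter_upwards [self_mem_nhdsWithin] with w hw
      rw [mul_div_cancel₀ _ (sub_ne_zero.2 hw)]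
    · refine sub_mul_tendsto_zero (l := r k / (p j - p k)) ?_
      have hne : p j - p k ≠ 0 := sub_ne_zero.2 fun e => h (hp e).symm
      exact ((tendsto_const_nhds (x := r k)).div ((continuous_id.sub continuous_const).tendsto (p j))
        hne).mono_left nhdsWithin_le_nhds
  have := tendsto_finsetSum Finset.univ (fun k _ => key k)
  simpa [poleSum, Finset.mul_sum] using this

theorem mul_poleSum_tendsto (p r : ι → ℂ) :
    Tendsto (fun w => w * poleSum p r w) (Bornology.cobounded ℂ) (𝓝 (∑ k, r k)) := by
  have key : ∀ k, Tendsto (fun w => w * (r k / (w - p k))) (Bornology.cobounded ℂ) (𝓝 (r k)) := by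
    intro k
    have h1 : Tendsto (fun w : ℂ => r k * (1 - p k * w⁻¹)⁻¹) (Bornology.cobounded ℂ) (𝓝 (r k)) := by
      have h0 : Tendsto (fun w : ℂ => 1 - p k * w⁻¹) (Bornology.cobounded ℂ) (𝓝 1) := by
        simpa using (tendsto_const_nhds (x := (1 : ℂ))).sub
          ((tendsto_inv₀_cobounded (α := ℂ)).const_mul (p k))
      simpa using (h0.inv₀ one_ne_zero).const_mul (r k)
    refine h1.congr' ?_
    filter_upwards [Bornology.isBounded_singleton (x := (0 : ℂ)),
      Bornology.isBounded_singleton (x := p k)] with w hw hw'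
    have h0 : w ≠ 0 := hw
    have h2 : w - p k ≠ 0 := sub_ne_zero.2 hw'
    have h3 : (1 - p k * w⁻¹) = (w - p k) / w := by field_simp
    rw [h3, inv_div]; ring
  have := tendsto_finsetSum Finset.univ (fun k _ => key k)
  simpa [poleSum, Finset.mul_sum] using this

theorem poleSum_isBigO (p r : ι → ℂ) :
    (poleSum p r) =O[Bornology.cobounded ℂ] (fun w => w⁻¹) := by
  have h := (mul_poleSum_tendsto p r).isBigO_one ℂ
  have h2 := (Asymptotics.isBigO_refl (fun w : ℂ => w⁻¹) (Bornology.cobounded ℂ)).mul h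
  refine (h2.congr' ?_ (by simp))
  filter_upwards [Bornology.isBounded_singleton (x := (0 : ℂ))] with w hw
  have h0 : w ≠ 0 := hw
  field_simp

theorem poleSum_tendsto_zero (p r : ι → ℂ) :
    Tendsto (poleSum p r) (Bornology.cobounded ℂ) (𝓝 0) :=
  (poleSum_isBigO p r).trans_tendsto tendsto_inv₀_cobounded

end PoleSum

/-! ### Reduction of the Riemann–Hilbert problem to a linear system. -/

section ResidueSystem

variable {N : ℕ}

/-- The linear system satisfied by the values `a j = M₁₁(conj z_j)` and `b j = M₁₂(z_j)` of a
solution of the reflectionless Riemann-Hilbert problem with residue coefficients `γ`. -/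
def IsResidueSystemSolution (z γ a b : Fin N → ℂ) : Prop :=
  (∀ j, a j = 1 + poleSum z (fun k => γ k * b k) (conj (z j))) ∧
    ∀ j, b j = -poleSum (fun k => conj (z k)) (fun k => conj (γ k) * a k) (z j)

theorem conj_poleSum (p r : Fin N → ℂ) (w : ℂ) :
    conj (poleSum p r w) = poleSum (fun k => conj (p k)) (fun k => conj (r k)) (conj w) := by
  simp [poleSum, map_sum]

/-- Applied twice over: to the determinant, and to the difference between a solution and its partial
fractions. -/
theorem eq_of_removable_of_tendsto {z : Fin N → ℂ} {f : ℂ → ℂ} {l : ℂ}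
    (hf : DifferentiableOn ℂ f {w | ∀ k, w ≠ z k ∧ w ≠ conj (z k)})
    (hz : ∀ k, Tendsto (fun w => (w - z k) * f w) (𝓝[≠] (z k)) (𝓝 0))
    (hz' : ∀ k, Tendsto (fun w => (w - conj (z k)) * f w) (𝓝[≠] (conj (z k))) (𝓝 0))
    (hinf : Tendsto f (Bornology.cobounded ℂ) (𝓝 l)) {w : ℂ}
    (hw : ∀ k, w ≠ z k ∧ w ≠ conj (z k)) : f w = l := by
  classical
  have h := eq_zero_of_removable_of_tendsto_zero
    (Finset.univ.image z ∪ Finset.univ.image fun k => conj (z k)) (fun w => f w - l) ?_ ?_ ?_ w ?_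
  · exact sub_eq_zero.1 h
  · refine (hf.mono fun x hx => ?_).sub (differentiableOn_const _)
    simp only [Set.mem_compl_iff, Finset.coe_union, Finset.coe_image, Finset.coe_univ,
      Set.image_univ, Set.mem_union, Set.mem_range, not_or, not_exists] at hx
    exact fun k => ⟨fun e => hx.1 k e.symm, fun e => hx.2 k e.symm⟩
  · intro s hs
    have hl := sub_mul_tendsto_zero (tendsto_const_nhds (x := l) (f := 𝓝[≠] s))
    simp only [Finset.mem_union, Finset.mem_image, Finset.mem_univ, true_and] at hs
    rcases hs with ⟨k, rfl⟩ | ⟨k, rfl⟩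
    · simpa [mul_sub] using (hz k).sub hl
    · simpa [mul_sub] using (hz' k).sub hl
  · simpa using hinf.sub_const l
  · simp only [Finset.mem_union, Finset.mem_image, Finset.mem_univ, true_and, not_or, not_exists]
    exact ⟨fun k e => (hw k).1 e.symm, fun k e => (hw k).2 e.symm⟩

theorem matrix_tendsto_of_entries {f : ℂ → Matrix (Fin 2) (Fin 2) ℂ} {l : Filter ℂ}
    {L : Matrix (Fin 2) (Fin 2) ℂ} (h : ∀ i j, Tendsto (fun w => f w i j) l (𝓝 (L i j))) :
    Tendsto f l (𝓝 L) :=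
  tendsto_pi_nhds.2 fun i => tendsto_pi_nhds.2 fun j => h i j

theorem matrix_entry_tendsto {f : ℂ → Matrix (Fin 2) (Fin 2) ℂ} {l : Filter ℂ}
    {L : Matrix (Fin 2) (Fin 2) ℂ} (h : Tendsto f l (𝓝 L)) (i j : Fin 2) :
    Tendsto (fun w => f w i j) l (𝓝 (L i j)) :=
  tendsto_pi_nhds.1 (tendsto_pi_nhds.1 h i) j

/-- The matrix with the pole structure of the Riemann-Hilbert problem, built from a solution of the
residue system. -/
noncomputable def residueMatrix (z γ a b : Fin N → ℂ) (w : ℂ) : Matrix (Fin 2) (Fin 2) ℂ :=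
  !![1 + poleSum z (fun k => γ k * b k) w,
      -poleSum (fun k => conj (z k)) (fun k => conj (γ k) * a k) w;
    poleSum z (fun k => γ k * conj (a k)) w,
      1 + poleSum (fun k => conj (z k)) (fun k => conj (γ k) * conj (b k)) w]

theorem poleSum_residue_one (p r : Fin N → ℂ) (hp : Function.Injective p) (j : Fin N) :
    Tendsto (fun w => (w - p j) * (1 + poleSum p r w)) (𝓝[≠] (p j)) (𝓝 (r j)) := by
  simpa [mul_add] using (tendsto_sub_nhdsNE (p j)).add (poleSum_residue p r hp j)

theorem conj_residue_coeff (c ζ : ℂ) (x t : ℝ) :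
    conj (c * exp (2 * I * nlsPhase ζ x t)) = conj c * exp (-2 * I * nlsPhase (conj ζ) x t) := by
  rw [map_mul, ← exp_conj]
  have h2 : conj (2 : ℂ) = 2 := map_ofNat _ 2
  simp [nlsPhase, h2]

/-- The second row is the Schwarz reflection of the first: M₂₂(w) = conj M₁₁(conj w) and M₂₁(w) =
-conj M₁₂(conj w). Conjugating the two equations of the residue system therefore gives the residue
conditions of the second row. -/
theorem solvesSolitonRHP_residueMatrix {z c a b : Fin N → ℂ} {x t : ℝ}
    (hz : Function.Injective z) (hne : ∀ j k, z j ≠ conj (z k))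
    (h : IsResidueSystemSolution z (fun k => c k * exp (2 * I * nlsPhase (z k) x t)) a b) :
    SolvesSolitonRHP z c x t
      (residueMatrix z (fun k => c k * exp (2 * I * nlsPhase (z k) x t)) a b) := by
  set γ : Fin N → ℂ := fun k => c k * exp (2 * I * nlsPhase (z k) x t) with hγ
  have hz' : Function.Injective fun k => conj (z k) := fun i j e => hz ((starRingEnd ℂ).injective e)
  have hne' : ∀ j k, conj (z j) ≠ z k := fun j k e => hne k j e.symm
  obtain ⟨ha, hb⟩ := h
  have ha' : ∀ j, 1 + poleSum (fun k => conj (z k)) (fun k => conj (γ k) * conj (b k)) (z j)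
      = conj (a j) := by
    intro j
    rw [ha j, map_add, conj_poleSum]
    simp
  have hb' : ∀ j, poleSum z (fun k => γ k * conj (a k)) (conj (z j)) = -conj (b j) := by
    intro j
    rw [hb j, map_neg, conj_poleSum]
    simp
  have hdiff : ∀ i j, DifferentiableOn ℂ (fun w => residueMatrix z γ a b w i j)
      {w | ∀ k, w ≠ z k ∧ w ≠ conj (z k)} := by
    intro i j w hw
    refine DifferentiableAt.differentiableWithinAt ?_
    have h1 := fun r => poleSum_differentiableAt z r fun k => (hw k).1
    have h2 := fun r => poleSum_differentiableAt (fun k => conj (z k)) r fun k => (hw k).2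
    fin_cases i <;> fin_cases j
    · exact (h1 _).const_add 1
    · exact (h2 _).neg
    · exact h1 _
    · exact (h2 _).const_add 1
  have l11 : ∀ k, Tendsto (fun w => (w - z k) * residueMatrix z γ a b w 0 0) (𝓝[≠] (z k))
      (𝓝 (γ k * b k)) := fun k => poleSum_residue_one z _ hz k
  have l21 : ∀ k, Tendsto (fun w => (w - z k) * residueMatrix z γ a b w 1 0) (𝓝[≠] (z k))
      (𝓝 (γ k * conj (a k))) := fun k => poleSum_residue z _ hz k
  have l12 : ∀ k, Tendsto (fun w => residueMatrix z γ a b w 0 1) (𝓝[≠] (z k)) (𝓝 (b k)) := by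
    intro k
    rw [hb k]
    exact (poleSum_tendsto _ _ fun j => hne k j).neg
  have l22 : ∀ k, Tendsto (fun w => residueMatrix z γ a b w 1 1) (𝓝[≠] (z k))
      (𝓝 (conj (a k))) := by
    intro k
    rw [← ha' k]
    exact (poleSum_tendsto _ _ fun j => hne k j).const_add 1
  have m12 : ∀ k, Tendsto (fun w => (w - conj (z k)) * residueMatrix z γ a b w 0 1)
      (𝓝[≠] (conj (z k))) (𝓝 (-(conj (γ k) * a k))) := by
    intro k
    simpa [residueMatrix] using
      (poleSum_residue _ (fun k => conj (γ k) * a k) hz' k).neg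
  have m22 : ∀ k, Tendsto (fun w => (w - conj (z k)) * residueMatrix z γ a b w 1 1)
      (𝓝[≠] (conj (z k))) (𝓝 (conj (γ k) * conj (b k))) :=
    fun k => poleSum_residue_one (fun k => conj (z k)) _ hz' k
  have m11 : ∀ k, Tendsto (fun w => residueMatrix z γ a b w 0 0) (𝓝[≠] (conj (z k)))
      (𝓝 (a k)) := by
    intro k
    rw [ha k]
    exact (poleSum_tendsto _ _ fun j => hne' k j).const_add 1
  have m21 : ∀ k, Tendsto (fun w => residueMatrix z γ a b w 1 0) (𝓝[≠] (conj (z k)))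
      (𝓝 (-conj (b k))) := by
    intro k
    rw [← hb' k]
    exact poleSum_tendsto _ _ fun j => hne' k j
  have hnorm : ∀ i j, (fun w => residueMatrix z γ a b w i j - (1 : Matrix (Fin 2) (Fin 2) ℂ) i j)
      =O[Bornology.cobounded ℂ] (fun w => w⁻¹) := by
    intro i j
    fin_cases i <;> fin_cases j
    · simpa [residueMatrix] using poleSum_isBigO _ _
    · simpa [residueMatrix] using poleSum_isBigO _ _
    · simpa [residueMatrix] using poleSum_isBigO _ _
    · simpa [residueMatrix] using poleSum_isBigO _ _
  have hinf : ∀ i j, Tendsto (fun w => residueMatrix z γ a b w i j) (Bornology.cobounded ℂ)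
      (𝓝 ((1 : Matrix (Fin 2) (Fin 2) ℂ) i j)) := by
    intro i j
    have := (hnorm i j).trans_tendsto tendsto_inv₀_cobounded
    simpa using this.add_const ((1 : Matrix (Fin 2) (Fin 2) ℂ) i j)
  refine ⟨hdiff, ?_, hnorm, ?_, ?_⟩
  · intro w hw
    simp_rw [Matrix.det_fin_two]
    -- At each pole the residue of the singular column is a multiple of the value of the other
    -- column, so the determinant has zero residue there; at infinity it tends to 1.
    refine eq_of_removable_of_tendsto (f := fun w => residueMatrix z γ a b w 0 0 *
      residueMatrix z γ a b w 1 1 - residueMatrix z γ a b w 0 1 * residueMatrix z γ a b w 1 0)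
      ?_ ?_ ?_ ?_ hw
    · exact ((hdiff 0 0).mul (hdiff 1 1)).sub ((hdiff 0 1).mul (hdiff 1 0))
    · intro k
      have := ((l11 k).mul (l22 k)).sub ((l12 k).mul (l21 k))
      have e : γ k * b k * conj (a k) - b k * (γ k * conj (a k)) = 0 := by ring
      rw [e] at this
      exact this.congr fun w => by ring
    · intro k
      have := ((m11 k).mul (m22 k)).sub ((m12 k).mul (m21 k))
      have e : a k * (conj (γ k) * conj (b k)) - -(conj (γ k) * a k) * -conj (b k) = 0 := by ring
      rw [e] at this
      exact this.congr fun w => by ring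
    · simpa using ((hinf 0 0).mul (hinf 1 1)).sub ((hinf 0 1).mul (hinf 1 0))
  · intro k
    refine ⟨!![γ k * b k, 0; γ k * conj (a k), 0], matrix_tendsto_of_entries fun i j => ?_,
      matrix_tendsto_of_entries fun i j => ?_⟩
    · fin_cases i <;> fin_cases j
      · simpa using l11 k
      · simpa using sub_mul_tendsto_zero (l12 k)
      · simpa using l21 k
      · simpa using sub_mul_tendsto_zero (l22 k)
    · fin_cases i <;> fin_cases j
      · simpa [Matrix.mul_apply, mul_comm, hγ] using (l12 k).mul_const (γ k)
      · simp [Matrix.mul_apply]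
      · simpa [Matrix.mul_apply, mul_comm, hγ] using (l22 k).mul_const (γ k)
      · simp [Matrix.mul_apply]
  · intro k
    rw [← conj_residue_coeff]
    change ∃ L, _ ∧ Tendsto (fun w => residueMatrix z γ a b w * !![0, -conj (γ k); 0, 0]) _ _
    refine ⟨!![0, -(conj (γ k) * a k); 0, conj (γ k) * conj (b k)],
      matrix_tendsto_of_entries fun i j => ?_, matrix_tendsto_of_entries fun i j => ?_⟩
    · fin_cases i <;> fin_cases j
      · simpa using sub_mul_tendsto_zero (m11 k)
      · simpa using m12 k
      · simpa using sub_mul_tendsto_zero (m21 k)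
      · simpa using m22 k
    · fin_cases i <;> fin_cases j
      · simp [Matrix.mul_apply]
      · simpa [Matrix.mul_apply, mul_comm] using (m11 k).mul_const (-conj (γ k))
      · simp [Matrix.mul_apply]
      · simpa [Matrix.mul_apply, mul_comm] using (m21 k).mul_const (-conj (γ k))

theorem residueMatrix_tendsto (z γ a b : Fin N → ℂ) :
    Tendsto (fun w => 2 * I * w * residueMatrix z γ a b w 0 1) (Bornology.cobounded ℂ)
      (𝓝 (-2 * I * ∑ k, conj (γ k) * a k)) := by
  have := (mul_poleSum_tendsto (fun k => conj (z k)) fun k => conj (γ k) * a k).const_mul (-2 * I)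
  refine this.congr fun w => ?_
  simp [residueMatrix]
  ring

/-- Only the first row matters. Since γ_k ≠ 0, the residue conditions force the regular entry to
have a limit at each pole. Subtracting partial fractions then leaves removable singularities, and
the limits of the resulting formulas at the poles form the system. -/
theorem SolvesSolitonRHP.exists_residueSystemSolution {z c : Fin N → ℂ} {x t : ℝ}
    {M : ℂ → Matrix (Fin 2) (Fin 2) ℂ} (hM : SolvesSolitonRHP z c x t M)
    (hz : Function.Injective z) (hne : ∀ j k, z j ≠ conj (z k)) (hc : ∀ k, c k ≠ 0) :
    ∃ a b, IsResidueSystemSolution z (fun k => c k * exp (2 * I * nlsPhase (z k) x t)) a b ∧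
      Tendsto (fun w => 2 * I * w * M w 0 1) (Bornology.cobounded ℂ)
        (𝓝 (-2 * I * ∑ k, conj (c k * exp (2 * I * nlsPhase (z k) x t)) * a k)) := by
  set γ : Fin N → ℂ := fun k => c k * exp (2 * I * nlsPhase (z k) x t) with hγ
  have hz' : Function.Injective fun k => conj (z k) := fun i j e => hz ((starRingEnd ℂ).injective e)
  have hne' : ∀ j k, conj (z j) ≠ z k := fun j k e => hne k j e.symm
  have hγ0 : ∀ k, γ k ≠ 0 := fun k => mul_ne_zero (hc k) (exp_ne_zero _)
  have hγ0' : ∀ k, -conj (γ k) ≠ 0 := fun k => neg_ne_zero.2 ((map_ne_zero _).2 (hγ0 k))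
  have hres : ∀ k, ∃ β, Tendsto (fun w => M w 0 1) (𝓝[≠] (z k)) (𝓝 β) ∧
      Tendsto (fun w => (w - z k) * M w 0 0) (𝓝[≠] (z k)) (𝓝 (γ k * β)) := by
    intro k
    obtain ⟨L, h1, h2⟩ := hM.residue k
    have h3 := matrix_entry_tendsto h1 0 0
    have h4 : Tendsto (fun w => M w 0 1 * γ k) (𝓝[≠] (z k)) (𝓝 (L 0 0)) := by
      simpa [Matrix.mul_apply, hγ] using matrix_entry_tendsto h2 0 0
    refine ⟨L 0 0 / γ k, ?_, ?_⟩
    · exact (h4.div_const (γ k)).congr fun w => by rw [mul_div_cancel_right₀ _ (hγ0 k)]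
    · rw [mul_div_cancel₀ _ (hγ0 k)]
      simpa using h3
  have hresc : ∀ k, ∃ α, Tendsto (fun w => M w 0 0) (𝓝[≠] (conj (z k))) (𝓝 α) ∧
      Tendsto (fun w => (w - conj (z k)) * M w 0 1) (𝓝[≠] (conj (z k)))
        (𝓝 (-(conj (γ k) * α))) := by
    intro k
    obtain ⟨L, h1, h2⟩ := hM.residue_conj k
    rw [← conj_residue_coeff] at h2
    have h3 := matrix_entry_tendsto h1 0 1
    have h4 : Tendsto (fun w => M w 0 0 * -conj (γ k)) (𝓝[≠] (conj (z k))) (𝓝 (L 0 1)) := by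
      simpa [Matrix.mul_apply, hγ] using matrix_entry_tendsto h2 0 1
    refine ⟨L 0 1 / -conj (γ k), ?_, ?_⟩
    · exact (h4.div_const _).congr fun w => by rw [mul_div_cancel_right₀ _ (hγ0' k)]
    · rw [← neg_mul, mul_div_cancel₀ _ (hγ0' k)]
      simpa using h3
  choose b hb1 hb2 using hres
  choose a ha1 ha2 using hresc
  have hinf : ∀ i j, Tendsto (fun w => M w i j) (Bornology.cobounded ℂ)
      (𝓝 ((1 : Matrix (Fin 2) (Fin 2) ℂ) i j)) := by
    intro i j
    have := (hM.normalized i j).trans_tendsto tendsto_inv₀_cobounded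
    simpa using this.add_const ((1 : Matrix (Fin 2) (Fin 2) ℂ) i j)
  have e11 : ∀ w, (∀ k, w ≠ z k ∧ w ≠ conj (z k)) →
      M w 0 0 = 1 + poleSum z (fun k => γ k * b k) w := by
    intro w hw
    rw [← sub_eq_iff_eq_add]
    refine eq_of_removable_of_tendsto
      (f := fun w => M w 0 0 - poleSum z (fun k => γ k * b k) w) ?_ ?_ ?_ ?_ hw
    · refine (hM.analytic 0 0).sub fun w hw => ?_
      exact (poleSum_differentiableAt z _ fun k => (hw k).1).differentiableWithinAt
    · intro k
      simpa [mul_sub] using (hb2 k).sub (poleSum_residue z (fun k => γ k * b k) hz k)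
    · intro k
      exact sub_mul_tendsto_zero ((ha1 k).sub (poleSum_tendsto z _ fun j => hne' k j))
    · simpa using (hinf 0 0).sub (poleSum_tendsto_zero z _)
  have e12 : ∀ w, (∀ k, w ≠ z k ∧ w ≠ conj (z k)) →
      M w 0 1 = -poleSum (fun k => conj (z k)) (fun k => conj (γ k) * a k) w := by
    intro w hw
    rw [eq_neg_iff_add_eq_zero]
    refine eq_of_removable_of_tendsto (f := fun w => M w 0 1 +
      poleSum (fun k => conj (z k)) (fun k => conj (γ k) * a k) w) ?_ ?_ ?_ ?_ hw
    · refine (hM.analytic 0 1).add fun w hw => ?_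
      exact (poleSum_differentiableAt _ _ fun k => (hw k).2).differentiableWithinAt
    · intro k
      exact sub_mul_tendsto_zero ((hb1 k).add (poleSum_tendsto _ _ fun j => hne k j))
    · intro k
      simpa [mul_add] using (ha2 k).add (poleSum_residue _ (fun k => conj (γ k) * a k) hz' k)
    · simpa using (hinf 0 1).add (poleSum_tendsto_zero _ _)
  have hgood : ∀ s, ∀ᶠ w in 𝓝[≠] s, ∀ k, w ≠ z k ∧ w ≠ conj (z k) := by
    intro s
    have key : ∀ p : ℂ, ∀ᶠ w in 𝓝[≠] s, w ≠ p := by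
      intro p
      by_cases h : s = p
      · subst h; exact self_mem_nhdsWithin
      · exact nhdsWithin_le_nhds (isOpen_ne.mem_nhds h)
    exact eventually_all.2 fun k => (key _).and (key _)
  refine ⟨a, b, ⟨fun j => ?_, fun j => ?_⟩, ?_⟩
  · refine tendsto_nhds_unique (ha1 j) (((poleSum_tendsto z _ fun k => hne' j k).const_add 1).congr' ?_)
    filter_upwards [hgood _] with w hw using (e11 w hw).symm
  · refine tendsto_nhds_unique (hb1 j) ((poleSum_tendsto _ _ fun k => hne j k).neg.congr' ?_)
    filter_upwards [hgood _] with w hw using (e12 w hw).symm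
  · refine (residueMatrix_tendsto z γ a b).congr' ?_
    have key : ∀ p : ℂ, ∀ᶠ w in Bornology.cobounded ℂ, w ≠ p :=
      fun p => Bornology.isBounded_singleton (x := p)
    have hbd : ∀ᶠ w in Bornology.cobounded ℂ, ∀ k, w ≠ z k ∧ w ≠ conj (z k) :=
      eventually_all.2 fun k => (key _).and (key _)
    filter_upwards [hbd] with w hw
    rw [e12 w hw]
    simp [residueMatrix]

end ResidueSystem

/-! ### Operator norms on ℓ² and Hilbert's inequality. -/

section HilbertInequality

open Matrix

variable {ι : Type*} [Fintype ι]

/-- The Euclidean norm of a complex vector. -/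
noncomputable def l2norm (u : ι → ℂ) : ℝ := ‖WithLp.toLp 2 u‖

theorem l2norm_nonneg (u : ι → ℂ) : 0 ≤ l2norm u := norm_nonneg _

theorem l2norm_sq (u : ι → ℂ) : l2norm u ^ 2 = ∑ k, ‖u k‖ ^ 2 :=
  EuclideanSpace.norm_sq_eq _

theorem l2norm_add_le (u w : ι → ℂ) : l2norm (u + w) ≤ l2norm u + l2norm w :=
  norm_add_le _ _

theorem l2norm_smul (c : ℂ) (u : ι → ℂ) : l2norm (c • u) = ‖c‖ * l2norm u :=
  norm_smul c (WithLp.toLp 2 u)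

theorem l2norm_mono {u w : ι → ℂ} {c : ℝ} (hc : 0 ≤ c) (h : ∀ k, ‖u k‖ ≤ c * ‖w k‖) :
    l2norm u ≤ c * l2norm w := by
  refine le_of_sq_le_sq ?_ (mul_nonneg hc (l2norm_nonneg w))
  rw [mul_pow, l2norm_sq, l2norm_sq, Finset.mul_sum]
  refine Finset.sum_le_sum fun k _ => ?_
  rw [← mul_pow]
  exact pow_le_pow_left₀ (norm_nonneg _) (h k) 2

theorem IsHermitian.l2norm_mulVec_le [DecidableEq ι] {A : Matrix ι ι ℂ} (hA : A.IsHermitian)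
    {c : ℝ} (hc : 0 ≤ c) (h : ∀ i, hA.eigenvalues i ^ 2 ≤ c ^ 2) (u : ι → ℂ) :
    l2norm (A *ᵥ u) ≤ c * l2norm u := by
  refine le_of_sq_le_sq ?_ (mul_nonneg hc (l2norm_nonneg u))
  set b := hA.eigenvectorBasis
  rw [mul_pow, l2norm, l2norm, ← b.sum_sq_norm_inner_right, ← b.sum_sq_norm_inner_right,
    Finset.mul_sum]
  refine Finset.sum_le_sum fun i _ => ?_
  have hb := hA.mulVec_eigenvectorBasis i
  have key : inner ℂ (b i) (WithLp.toLp 2 (A *ᵥ u)) =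
      (hA.eigenvalues i : ℂ) * inner ℂ (b i) (WithLp.toLp 2 u) := by
    simp only [EuclideanSpace.inner_eq_star_dotProduct]
    change (A *ᵥ u) ⬝ᵥ star (⇑(b i)) = _ * (u ⬝ᵥ star (⇑(b i)))
    rw [dotProduct_comm, dotProduct_mulVec]
    have h1 : star (⇑(b i)) ᵥ* A = star (A *ᵥ ⇑(b i)) := by
      rw [star_mulVec, hA.eq]
    rw [h1, hb, dotProduct_comm u]
    simp [star_smul, smul_dotProduct, b]
  rw [key, norm_mul, mul_pow, Complex.norm_real, Real.norm_eq_abs, sq_abs]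
  exact mul_le_mul_of_nonneg_right (h i) (sq_nonneg _)

/-- **Schur's test** for a symmetric majorant. -/
theorem l2norm_mulVec_le_of_sum_le {A : Matrix ι ι ℂ} {q : ι → ι → ℝ} {ρ : ℝ}
    (hq : ∀ k l, ‖A k l‖ ≤ q k l) (hsymm : ∀ k l, q k l = q l k) (hρ0 : 0 ≤ ρ)
    (hρ : ∀ k, ∑ l, q k l ≤ ρ) (u : ι → ℂ) : l2norm (A *ᵥ u) ≤ ρ * l2norm u := by
  have hq0 : ∀ k l, 0 ≤ q k l := fun k l => (norm_nonneg _).trans (hq k l)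
  refine le_of_sq_le_sq ?_ (mul_nonneg hρ0 (l2norm_nonneg u))
  rw [mul_pow, l2norm_sq, l2norm_sq]
  have h1 : ∀ k, ‖(A *ᵥ u) k‖ ^ 2 ≤ ρ * ∑ l, q k l * ‖u l‖ ^ 2 := by
    intro k
    have h2 : ‖(A *ᵥ u) k‖ ≤ ∑ l, q k l * ‖u l‖ := by
      refine (norm_sum_le _ _).trans (Finset.sum_le_sum fun l _ => ?_)
      rw [norm_mul]
      exact mul_le_mul_of_nonneg_right (hq k l) (norm_nonneg _)
    calc ‖(A *ᵥ u) k‖ ^ 2 ≤ (∑ l, q k l * ‖u l‖) ^ 2 := pow_le_pow_left₀ (norm_nonneg _) h2 2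
      _ ≤ (∑ l, q k l) * ∑ l, q k l * ‖u l‖ ^ 2 :=
        Finset.sum_sq_le_sum_mul_sum_of_sq_le_mul _ (fun l _ => hq0 k l)
          (fun l _ => mul_nonneg (hq0 k l) (sq_nonneg _)) fun l _ => (by ring : _ = _).le
      _ ≤ _ := mul_le_mul_of_nonneg_right (hρ k)
        (Finset.sum_nonneg fun l _ => mul_nonneg (hq0 k l) (sq_nonneg _))
  calc ∑ k, ‖(A *ᵥ u) k‖ ^ 2 ≤ ∑ k, ρ * ∑ l, q k l * ‖u l‖ ^ 2 := Finset.sum_le_sum fun k _ => h1 k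
    _ = ρ * ∑ l, (∑ k, q l k) * ‖u l‖ ^ 2 := by
      rw [← Finset.mul_sum, Finset.sum_comm]
      simp_rw [Finset.sum_mul, hsymm]
    _ ≤ ρ * ∑ l, ρ * ‖u l‖ ^ 2 := by
      gcongr with l
      exact hρ l
    _ = ρ ^ 2 * ∑ l, ‖u l‖ ^ 2 := by rw [← Finset.mul_sum]; ring

/-- The bound on the eigenvalues in the Montgomery-Vaughan proof of Hilbert's inequality. -/
theorem hilbert_eigenvalue_sq_le {v : ι → ℝ} (hv : Function.Injective v) {ρ : ℝ}
    (hρ : ∀ k, ∑ l, ((v k - v l)⁻¹) ^ 2 ≤ ρ) {u : ι → ℂ} {κ : ℝ}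
    (hu : ∀ k, ∑ l, (((v k - v l)⁻¹ : ℝ) : ℂ) * u l = -I * κ * u k) :
    κ ^ 2 * ∑ k, ‖u k‖ ^ 2 ≤ 3 * ρ * ∑ k, ‖u k‖ ^ 2 := by
  classical
  set t : ι → ι → ℝ := fun k l => (v k - v l)⁻¹ with ht
  have hanti : ∀ k l, t k l = -t l k := by
    intro k l
    simp only [ht]
    rw [← inv_neg, neg_sub]
  have htkk : ∀ k, t k k = 0 := by simp [ht]
  set σ : ι → ℝ := fun k => ∑ l, t k l with hσ
  -- For distinct indices, 1/(xy) = (1/x + 1/y)/(x + y) with x = v_l - v_k and y = v_k - v_m.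
  -- Because `0⁻¹ = 0`, the identity fails at k = l and k = m by t_lm² each, whence the term 2
  -- t_lm².
  have hprod : ∀ l m, ∑ k, t l k * t k m =
      t l m * (σ l - σ m) - 2 * t l m ^ 2 - if l = m then ∑ k, t l k ^ 2 else 0 := by
    intro l m
    split_ifs with h
    · subst h
      rw [htkk, ← sub_eq_zero]
      have : ∀ k, t l k * t k l = -(t l k ^ 2) := fun k => by rw [hanti k l]; ring
      simp [this]
    · have hlm : v l - v m ≠ 0 := sub_ne_zero.2 fun e => h (hv e)
      have h1 : ∀ k, t l k * t k m = t l m * (t l k + t k m)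
          - (if k = l then t l m ^ 2 else 0) - (if k = m then t l m ^ 2 else 0) := by
        intro k
        by_cases hk : k = l
        · subst hk
          rw [htkk]; simp [h]; ring
        · by_cases hk' : k = m
          · subst hk'
            rw [htkk]; simp [hk]; ring
          · have h2 : v l - v k ≠ 0 := sub_ne_zero.2 fun e => hk (hv e).symm
            have h3 : v k - v m ≠ 0 := sub_ne_zero.2 fun e => hk' (hv e)
            simp only [ht, hk, hk', if_false, sub_zero]
            field_simp
            ring
      have h2 : ∑ k, t k m = -σ m := by
        rw [hσ, ← Finset.sum_neg_distrib]
        exact Finset.sum_congr rfl fun k _ => hanti k m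
      simp_rw [h1, Finset.sum_sub_distrib, ← Finset.mul_sum, Finset.sum_add_distrib, h2]
      simp [hσ]
      ring
  have hquad : ∀ l, (κ : ℂ) ^ 2 * u l = 2 * (∑ m, ((t l m ^ 2 : ℝ) : ℂ) * u m)
      + ((∑ k, t l k ^ 2 : ℝ) : ℂ) * u l + (∑ m, (t l m : ℂ) * ((σ m : ℂ) * u m))
      + I * κ * (σ l * u l) := by
    intro l
    have e1 : ∑ k, (t l k : ℂ) * ∑ m, (t k m : ℂ) * u m = -(κ : ℂ) ^ 2 * u l := by
      have : ∀ k, (t l k : ℂ) * ∑ m, (t k m : ℂ) * u m = -I * κ * ((t l k : ℂ) * u k) := by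
        intro k
        rw [hu k]; ring
      simp_rw [this]
      rw [← Finset.mul_sum, hu l]
      linear_combination (κ : ℂ) ^ 2 * u l * I_sq
    have e2 : ∑ k, (t l k : ℂ) * ∑ m, (t k m : ℂ) * u m
        = ∑ m, ((∑ k, t l k * t k m : ℝ) : ℂ) * u m := by
      simp_rw [Finset.mul_sum]
      rw [Finset.sum_comm]
      refine Finset.sum_congr rfl fun m _ => ?_
      rw [ofReal_sum, Finset.sum_mul]
      refine Finset.sum_congr rfl fun k _ => ?_
      push_cast; ring
    have e3 : ∀ m, ((∑ k, t l k * t k m : ℝ) : ℂ) * u m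
        = σ l * ((t l m : ℂ) * u m) - (t l m : ℂ) * ((σ m : ℂ) * u m)
          - 2 * (((t l m ^ 2 : ℝ) : ℂ) * u m)
          - if l = m then ((∑ k, t l k ^ 2 : ℝ) : ℂ) * u l else 0 := by
      intro m
      rw [hprod]
      split_ifs with h
      · subst h; push_cast; ring
      · push_cast; ring
    rw [e2] at e1
    simp_rw [e3, Finset.sum_sub_distrib, ← Finset.mul_sum] at e1
    rw [hu l] at e1
    simp only [Finset.sum_ite_eq, Finset.mem_univ, if_true] at e1
    linear_combination e1
  -- The conditionally convergent sums σ drop out: antisymmetry of t and the eigenvalue equation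
  -- turn the pairing of u with t(σu) into -iκ Σ σ_m |u_m|². Only squares of t remain, twice off the
  -- diagonal and once on it, hence the factor 3.
  have hcancel : ∑ l, conj (u l) * ((∑ m, (t l m : ℂ) * ((σ m : ℂ) * u m))
      + I * κ * (σ l * u l)) = 0 := by
    simp_rw [mul_add, Finset.sum_add_distrib, Finset.mul_sum]
    rw [Finset.sum_comm, ← Finset.sum_add_distrib]
    refine Finset.sum_eq_zero fun m _ => ?_
    have h1 : ∑ l, (t l m : ℂ) * conj (u l) = -(I * κ * conj (u m)) := by
      have := congrArg conj (hu m)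
      simp only [map_sum, map_mul, map_neg, conj_ofReal, conj_I] at this
      have h2 : ∑ l, (t l m : ℂ) * conj (u l) = -∑ l, (t m l : ℂ) * conj (u l) := by
        rw [← Finset.sum_neg_distrib]
        refine Finset.sum_congr rfl fun l _ => ?_
        rw [hanti l m]; push_cast; ring
      rw [h2, this]; ring
    have h3 : ∑ l, conj (u l) * ((t l m : ℂ) * ((σ m : ℂ) * u m))
        = (∑ l, (t l m : ℂ) * conj (u l)) * (σ m * u m) := by
      rw [Finset.sum_mul]
      exact Finset.sum_congr rfl fun l _ => by ring
    rw [h3, h1]; ring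
  have hform : (κ : ℂ) ^ 2 * ∑ l, conj (u l) * u l =
      2 * (∑ l, conj (u l) * ∑ m, ((t l m ^ 2 : ℝ) : ℂ) * u m)
        + ∑ l, ((∑ k, t l k ^ 2 : ℝ) : ℂ) * (conj (u l) * u l) := by
    have : ∀ l, (κ : ℂ) ^ 2 * (conj (u l) * u l) =
        2 * (conj (u l) * ∑ m, ((t l m ^ 2 : ℝ) : ℂ) * u m)
          + ((∑ k, t l k ^ 2 : ℝ) : ℂ) * (conj (u l) * u l)
          + conj (u l) * ((∑ m, (t l m : ℂ) * ((σ m : ℂ) * u m)) + I * κ * (σ l * u l)) := by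
      intro l
      linear_combination conj (u l) * hquad l
    rw [Finset.mul_sum]
    simp_rw [this, Finset.sum_add_distrib, hcancel, ← Finset.mul_sum, add_zero]
  have hnn : ∀ l, conj (u l) * u l = ((‖u l‖ ^ 2 : ℝ) : ℂ) := by
    intro l
    rw [mul_comm, mul_conj, normSq_eq_norm_sq]
  have hdiag : ∑ l, (∑ k, t l k ^ 2) * ‖u l‖ ^ 2 ≤ ρ * ∑ l, ‖u l‖ ^ 2 := by
    rw [Finset.mul_sum]
    exact Finset.sum_le_sum fun l _ => mul_le_mul_of_nonneg_right (hρ l) (sq_nonneg _)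
  have hoff : ‖∑ l, conj (u l) * ∑ m, ((t l m ^ 2 : ℝ) : ℂ) * u m‖ ≤ ρ * ∑ l, ‖u l‖ ^ 2 := by
    calc _ ≤ ∑ l, ∑ m, t l m ^ 2 * ((‖u l‖ ^ 2 + ‖u m‖ ^ 2) / 2) := by
          refine (norm_sum_le _ _).trans (Finset.sum_le_sum fun l _ => ?_)
          rw [Finset.mul_sum]
          refine (norm_sum_le _ _).trans (Finset.sum_le_sum fun m _ => ?_)
          rw [norm_mul, norm_mul, RCLike.norm_conj, Complex.norm_real, Real.norm_eq_abs,
            abs_of_nonneg (sq_nonneg _)]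
          nlinarith [mul_nonneg (sq_nonneg (t l m)) (sq_nonneg (‖u l‖ - ‖u m‖))]
      _ = ∑ l, (∑ k, t l k ^ 2) * ‖u l‖ ^ 2 := by
          have h1 : ∑ l, ∑ m, t l m ^ 2 * ‖u m‖ ^ 2 = ∑ l, ∑ m, t l m ^ 2 * ‖u l‖ ^ 2 := by
            rw [Finset.sum_comm]
            refine Finset.sum_congr rfl fun l _ => Finset.sum_congr rfl fun m _ => ?_
            rw [hanti m l, neg_sq]
          have h2 : ∀ l m, t l m ^ 2 * ((‖u l‖ ^ 2 + ‖u m‖ ^ 2) / 2) =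
              t l m ^ 2 * ‖u l‖ ^ 2 / 2 + t l m ^ 2 * ‖u m‖ ^ 2 / 2 := fun l m => by ring
          simp_rw [h2, Finset.sum_add_distrib, ← Finset.sum_div, h1, Finset.sum_mul]
          ring
      _ ≤ _ := hdiag
  have hn := congrArg norm hform
  simp_rw [hnn, ← ofReal_mul, ← ofReal_sum, ← ofReal_pow, ← ofReal_mul] at hn
  rw [Complex.norm_real, Real.norm_eq_abs] at hn
  have hfin := (le_abs_self _).trans (hn.le.trans (norm_add_le _ _))
  rw [norm_mul, Complex.norm_ofNat, Complex.norm_real, Real.norm_eq_abs, abs_of_nonneg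
    (Finset.sum_nonneg fun l _ => mul_nonneg (Finset.sum_nonneg fun k _ => sq_nonneg _)
      (sq_nonneg _))] at hfin
  nlinarith

/-- **Hilbert's inequality** of Montgomery and Vaughan, with a cruder constant. -/
theorem hilbert_inequality {v : ι → ℝ} (hv : Function.Injective v) {c : ℝ} (hc : 0 ≤ c)
    (hρ : ∀ k, 3 * ∑ l, ((v k - v l)⁻¹) ^ 2 ≤ c ^ 2) (u : ι → ℂ) :
    l2norm (Matrix.of (fun k l => (((v k - v l)⁻¹ : ℝ) : ℂ)) *ᵥ u) ≤ c * l2norm u := by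
  classical
  set t : Matrix ι ι ℂ := Matrix.of (fun k l => (((v k - v l)⁻¹ : ℝ) : ℂ)) with ht
  -- A real antisymmetric matrix becomes Hermitian after multiplication by i, so its norm is read
  -- off from real eigenvalues.
  have hA : (I • t).IsHermitian := by
    ext k l
    simp only [ht, Matrix.conjTranspose_apply, Matrix.smul_apply, Matrix.of_apply, smul_eq_mul,
      RCLike.star_def, map_mul, conj_I, conj_ofReal]
    rw [← neg_sub (v k) (v l), inv_neg]
    push_cast; ring
  have key := IsHermitian.l2norm_mulVec_le hA hc (fun i => ?_) u
  · rwa [smul_mulVec, l2norm_smul, norm_I, one_mul] at key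
  · have hb := hA.mulVec_eigenvectorBasis i
    set w : ι → ℂ := ⇑(hA.eigenvectorBasis i) with hw
    have hw1 : ∑ k, ‖w k‖ ^ 2 = 1 := by
      have h1 := hA.eigenvectorBasis.orthonormal.1 i
      rw [← EuclideanSpace.norm_sq_eq, h1, one_pow]
    have h2 := hilbert_eigenvalue_sq_le hv (ρ := c ^ 2 / 3) (fun k => by linarith [hρ k]) (u := w)
      (κ := hA.eigenvalues i) (fun k => by
        have h3 := congrFun hb k
        simp only [smul_mulVec, Pi.smul_apply, smul_eq_mul, real_smul] at h3
        have h4 : (t *ᵥ w) k = ∑ l, (((v k - v l)⁻¹ : ℝ) : ℂ) * w l := rfl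
        rw [← h4]
        linear_combination (-I) * h3 + (t *ᵥ w) k * I_sq)
    rw [hw1] at h2
    linarith

end HilbertInequality

/-! ### The interaction matrix and stability of the residue system. -/

section Interaction

open Matrix

variable {N : ℕ}

/-- The off-diagonal part of the Cauchy matrix `i μ / (z_k - conj z_l)` of the soliton poles. -/
noncomputable def interactionMatrix (μ : ℝ) (v : Fin N → ℝ) : Matrix (Fin N) (Fin N) ℂ :=
  Matrix.of fun k l => if k = l then 0 else 2 * I * μ / ((v l - v k : ℝ) + 2 * I * μ)

theorem sub_add_two_I_mul_ne_zero {μ : ℝ} (hμ : μ ≠ 0) (d : ℝ) : (d : ℂ) + 2 * I * μ ≠ 0 := by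
  intro h
  have := congrArg Complex.im h
  simp at this
  exact hμ this

theorem abs_le_norm_add_two_I_mul (d μ : ℝ) : |d| ≤ ‖(d : ℂ) + 2 * I * μ‖ := by
  have := abs_re_le_norm ((d : ℂ) + 2 * I * μ)
  simpa using this

theorem interactionMatrix_bound {μ Δ : ℝ} {v : Fin N → ℝ} (hv : Function.Injective v)
    (hμ : 0 < μ) (hΔ : 100 * μ < Δ) (hρ : ∀ k, ∑ l, ((v k - v l)⁻¹) ^ 2 ≤ 4 / Δ ^ 2)
    (u : Fin N → ℂ) :
    l2norm (interactionMatrix μ v *ᵥ u) ≤ 10 * μ / Δ * l2norm u := by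
  have hΔ0 : 0 < Δ := by linarith
  set t : Matrix (Fin N) (Fin N) ℂ := Matrix.of (fun k l => (((v k - v l)⁻¹ : ℝ) : ℂ)) with ht
  have h1 : l2norm (t *ᵥ u) ≤ 4 / Δ * l2norm u := by
    refine hilbert_inequality hv (by positivity) (fun k => ?_) u
    calc 3 * ∑ l, ((v k - v l)⁻¹) ^ 2 ≤ 3 * (4 / Δ ^ 2) := by gcongr; exact hρ k
      _ = 12 / Δ ^ 2 := by ring
      _ ≤ 16 / Δ ^ 2 := by gcongr; norm_num
      _ = (4 / Δ) ^ 2 := by ring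
  -- With d = v_l - v_k, removing the pole 2iμ/d from 2iμ/(d + 2iμ) leaves 4μ²/(d(d + 2iμ)), of size
  -- at most 4μ²/d². The two parts contribute 2μ · 4/Δ and at most 2μ/Δ, together 10 μ/Δ.
  set C : Matrix (Fin N) (Fin N) ℂ := interactionMatrix μ v + (2 * I * μ) • t with hC
  have h2 : l2norm (C *ᵥ u) ≤ (4 * μ ^ 2 * (4 / Δ ^ 2)) * l2norm u := by
    refine l2norm_mulVec_le_of_sum_le (q := fun k l => 4 * μ ^ 2 * ((v k - v l)⁻¹) ^ 2)
      (fun k l => ?_) (fun k l => ?_) (by positivity) (fun k => ?_) u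
    · by_cases hkl : k = l
      · subst hkl
        simp [hC, ht, interactionMatrix]
      · have hd : v l - v k ≠ 0 := sub_ne_zero.2 fun e => hkl (hv e).symm
        have hd' : ((v l - v k : ℝ) : ℂ) ≠ 0 := ofReal_ne_zero.2 hd
        have hn := sub_add_two_I_mul_ne_zero hμ.ne' (v l - v k)
        have e : C k l = 4 * μ ^ 2 / (((v l - v k : ℝ) : ℂ) * ((v l - v k : ℝ) + 2 * I * μ)) := by
          have e0 : (((v k - v l)⁻¹ : ℝ) : ℂ) = -(((v l - v k : ℝ) : ℂ))⁻¹ := by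
            rw [← neg_sub, inv_neg]; push_cast; ring
          simp only [hC, ht, interactionMatrix, Matrix.add_apply, Matrix.smul_apply,
            Matrix.of_apply, hkl, if_false, smul_eq_mul, e0]
          field_simp
          ring_nf
          simp [I_sq]
        rw [e, norm_div]
        have hnum : ‖(4 * μ ^ 2 : ℂ)‖ = 4 * μ ^ 2 := by simp
        rw [hnum, norm_mul, Complex.norm_real, Real.norm_eq_abs, div_eq_mul_inv]
        have hd0 : 0 < |v l - v k| := abs_pos.2 hd
        have e3 : ((v k - v l)⁻¹) ^ 2 = (|v l - v k| * |v l - v k|)⁻¹ := by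
          rw [abs_mul_abs_self, ← neg_sub, inv_neg, neg_sq, mul_inv, sq]
        rw [e3]
        gcongr
        exact abs_le_norm_add_two_I_mul _ _
    · rw [← neg_sub, inv_neg, neg_sq]
    · rw [← Finset.mul_sum]
      gcongr
      exact hρ k
  have e : interactionMatrix μ v *ᵥ u = C *ᵥ u + (-(2 * I * μ)) • (t *ᵥ u) := by
    rw [hC, add_mulVec, smul_mulVec]
    simp
  rw [e]
  refine (l2norm_add_le _ _).trans ?_
  rw [l2norm_smul]
  have hn : ‖(-(2 * I * μ) : ℂ)‖ = 2 * μ := by simp [abs_of_pos hμ]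
  rw [hn]
  have hu := l2norm_nonneg u
  have h3 : 4 * μ ^ 2 * (4 / Δ ^ 2) ≤ 2 * μ / Δ := by
    rw [mul_div_assoc', div_le_div_iff₀ (by positivity) hΔ0]
    nlinarith [mul_pos hμ hΔ0, mul_pos (mul_pos hμ hΔ0) hΔ0, mul_pos (mul_pos hμ hΔ0) hμ]
  calc _ ≤ 2 * μ / Δ * l2norm u + 2 * μ * (4 / Δ * l2norm u) := by gcongr; exact h2.trans (by gcongr)
    _ = _ := by ring

theorem solitonPole_sub_conj (μ v w : ℝ) :
    solitonPole μ v - conj (solitonPole μ w) = ((w - v : ℝ) + 2 * I * μ) / 2 := by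
  have h2 : conj (2 : ℂ) = 2 := map_ofNat _ 2
  simp only [solitonPole, map_div₀, map_add, map_neg, map_mul, conj_ofReal, conj_I, h2]
  push_cast; ring

theorem poleSum_conj_solitonPole {μ : ℝ} (hμ : μ ≠ 0) (v : Fin N → ℝ) (r : Fin N → ℂ)
    (j : Fin N) :
    poleSum (fun k => conj (solitonPole μ (v k))) r (solitonPole μ (v j)) =
      -(I / μ) * (r + interactionMatrix μ v *ᵥ r) j := by
  have hμ' : (μ : ℂ) ≠ 0 := ofReal_ne_zero.2 hμ
  have h1 : r j = ∑ k, if j = k then r k else 0 := by simp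
  rw [Pi.add_apply, h1]
  simp only [poleSum, mulVec, dotProduct, ← Finset.sum_add_distrib, Finset.mul_sum]
  refine Finset.sum_congr rfl fun k _ => ?_
  rw [solitonPole_sub_conj]
  have hn := sub_add_two_I_mul_ne_zero hμ (v k - v j)
  by_cases hjk : j = k
  · subst hjk
    simp only [interactionMatrix, Matrix.of_apply, if_true, sub_self, ofReal_zero, zero_add]
    have hI := I_ne_zero
    field_simp
    simp
  · simp only [interactionMatrix, Matrix.of_apply, hjk, if_false, zero_add]
    field_simp
    ring_nf
    simp

/-- The conjugate matrix belongs to the reflected velocities, which are equally separated, so one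
norm bound serves both. -/
theorem interactionMatrix_neg {μ : ℝ} (v : Fin N → ℝ) :
    interactionMatrix μ (-v) = (interactionMatrix μ v).map conj := by
  ext k l
  simp only [interactionMatrix, Matrix.of_apply, Matrix.map_apply]
  split_ifs with h
  · simp
  · have h2 : conj (2 : ℂ) = 2 := map_ofNat _ 2
    simp only [map_div₀, map_mul, map_add, h2, conj_I, conj_ofReal]
    rw [← neg_div_neg_eq]
    congr 1
    · ring
    · simp only [Pi.neg_apply]; push_cast; ring

theorem poleSum_solitonPole_conj {μ : ℝ} (hμ : μ ≠ 0) (v : Fin N → ℝ) (r : Fin N → ℂ)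
    (j : Fin N) :
    poleSum (fun k => solitonPole μ (v k)) r (conj (solitonPole μ (v j))) =
      (I / μ) * (r + interactionMatrix μ (-v) *ᵥ r) j := by
  have h := congrArg conj (poleSum_conj_solitonPole hμ v (fun k => conj (r k)) j)
  rw [conj_poleSum] at h
  simp only [conj_conj] at h
  rw [h, interactionMatrix_neg]
  simp [mulVec, dotProduct, map_sum]
  ring

/-- The matrix of the residue system, with residue coefficients `μ * conj (g k)`, after elimination
of the values of the second column. -/
noncomputable def collisionMatrix (μ : ℝ) (v : Fin N → ℝ) (g : Fin N → ℂ) :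
    Matrix (Fin N) (Fin N) ℂ :=
  1 + (1 + interactionMatrix μ (-v)) * diagonal (star g) * (1 + interactionMatrix μ v) * diagonal g

theorem collisionMatrix_mulVec (μ : ℝ) (v : Fin N → ℝ) (g a : Fin N → ℂ) :
    collisionMatrix μ v g *ᵥ a = a + (star g * (g * a + interactionMatrix μ v *ᵥ (g * a)) +
      interactionMatrix μ (-v) *ᵥ (star g * (g * a + interactionMatrix μ v *ᵥ (g * a)))) := by
  have hd : ∀ g a : Fin N → ℂ, diagonal g *ᵥ a = g * a := fun g a => by
    ext k; simp [mulVec_diagonal]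
  simp only [collisionMatrix, add_mulVec, one_mulVec, ← mulVec_mulVec, hd]

/-- The factor μ in γ cancels the 1/μ of the Cauchy matrix. Since b is explicit in a, the system
reduces to a single equation for a. -/
theorem isResidueSystemSolution_iff {μ : ℝ} (hμ : μ ≠ 0) (v : Fin N → ℝ) (g γ : Fin N → ℂ)
    (hγ : ∀ k, conj (γ k) = μ * g k) (a b : Fin N → ℂ) :
    IsResidueSystemSolution (fun k => solitonPole μ (v k)) γ a b ↔
      collisionMatrix μ v g *ᵥ a = 1 ∧
        b = I • (g * a + interactionMatrix μ v *ᵥ (g * a)) := by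
  have hμ' : (μ : ℂ) ≠ 0 := ofReal_ne_zero.2 hμ
  have hγ' : ∀ k, γ k = μ * conj (g k) := fun k => by
    rw [← conj_conj (γ k), hγ, map_mul, conj_ofReal]
  have hb : ((fun k => conj (γ k) * a k) : Fin N → ℂ) = (μ : ℂ) • (g * a) := by
    ext k; simp [hγ]; ring
  set W := g * a + interactionMatrix μ v *ᵥ (g * a) with hW
  have h1 : ∀ j, -poleSum (fun k => conj (solitonPole μ (v k))) (fun k => conj (γ k) * a k)
      (solitonPole μ (v j)) = (I • W) j := by
    intro j
    rw [poleSum_conj_solitonPole hμ, hb, mulVec_smul, ← smul_add]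
    simp only [Pi.smul_apply, smul_eq_mul, ← hW]
    field_simp
  have h2 : ∀ j, poleSum (fun k => solitonPole μ (v k)) (fun k => γ k * (I • W) k)
      (conj (solitonPole μ (v j))) = -(star g * W + interactionMatrix μ (-v) *ᵥ (star g * W)) j := by
    intro j
    have e : ((fun k => γ k * (I • W) k) : Fin N → ℂ) = (μ * I : ℂ) • (star g * W) := by
      ext k; simp [hγ']; ring
    rw [poleSum_solitonPole_conj hμ, e, mulVec_smul, ← smul_add]
    simp only [Pi.smul_apply, smul_eq_mul]
    field_simp
    simp
  rw [collisionMatrix_mulVec, ← hW]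
  constructor
  · rintro ⟨ha, hbj⟩
    have hbW : b = I • W := funext fun j => (hbj j).trans (h1 j)
    refine ⟨funext fun j => ?_, hbW⟩
    have := ha j
    rw [hbW, h2] at this
    rw [Pi.add_apply, this, Pi.one_apply]
    ring
  · rintro ⟨ha, rfl⟩
    refine ⟨fun j => ?_, fun j => (h1 j).symm⟩
    rw [h2]
    have := congrFun ha j
    rw [Pi.add_apply, Pi.one_apply] at this
    linear_combination this

/-- Stability of `a + (1 + E₂) y = f`, where `y` comes from `a` by a nonnegative form. -/
theorem norm_le_of_accretive {H : Type*} [NormedAddCommGroup H] [InnerProductSpace ℂ H]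
    {a w e y e₂ f : H} (h : inner ℂ y a = inner ℂ (w + e) w) (he : ‖e‖ ≤ 1 / 2 * ‖w‖)
    (he₂ : ‖e₂‖ ≤ 1 / 2 * ‖y‖) (hf : f = a + (y + e₂)) : ‖a‖ ≤ 4 * ‖f‖ := by
  have h1 : (inner ℂ y f).re = (inner ℂ w w).re + (inner ℂ e w).re + ((inner ℂ y y).re
      + (inner ℂ y e₂).re) := by
    rw [hf, inner_add_right, inner_add_right, h, inner_add_left]
    simp
  have h2 : (inner ℂ w w).re = ‖w‖ ^ 2 := inner_self_eq_norm_sq (𝕜 := ℂ) w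
  have h3 : (inner ℂ y y).re = ‖y‖ ^ 2 := inner_self_eq_norm_sq (𝕜 := ℂ) y
  have h4 : |(inner ℂ e w).re| ≤ ‖e‖ * ‖w‖ := (abs_re_le_norm _).trans (norm_inner_le_norm _ _)
  have h5 : |(inner ℂ y e₂).re| ≤ ‖y‖ * ‖e₂‖ := (abs_re_le_norm _).trans (norm_inner_le_norm _ _)
  have h6 : |(inner ℂ y f).re| ≤ ‖y‖ * ‖f‖ := (abs_re_le_norm _).trans (norm_inner_le_norm _ _)
  have hw := norm_nonneg w
  have hy := norm_nonneg y
  -- Pair f with y: Re⟨y, a⟩ ≥ ‖w‖²/2 ≥ 0 is discarded, and Re⟨y, y + e₂⟩ ≥ ‖y‖²/2. Hence ‖y‖ ≤ 2‖f‖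
  -- and ‖a‖ ≤ ‖f‖ + (3/2)‖y‖ ≤ 4‖f‖.
  have h7 : ‖y‖ ^ 2 ≤ 2 * (‖y‖ * ‖f‖) := by
    nlinarith [abs_le.1 h4, abs_le.1 h5, abs_le.1 h6, mul_le_mul_of_nonneg_right he hw,
      mul_le_mul_of_nonneg_left he₂ hy]
  have h8 : ‖y‖ ≤ 2 * ‖f‖ := by
    by_contra! hlt
    nlinarith [norm_nonneg f]
  have h9 : a = f - (y + e₂) := by rw [hf]; abel
  calc ‖a‖ ≤ ‖f‖ + (‖y‖ + ‖e₂‖) := by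
        rw [h9]
        exact (norm_sub_le _ _).trans (by gcongr; exact norm_add_le _ _)
    _ ≤ 4 * ‖f‖ := by linarith

theorem l2norm_le_collisionMatrix {μ : ℝ} {v : Fin N → ℝ} {ε : ℝ} (hε : ε ≤ 1 / 2)
    (h1 : ∀ u, l2norm (interactionMatrix μ v *ᵥ u) ≤ ε * l2norm u)
    (h2 : ∀ u, l2norm (interactionMatrix μ (-v) *ᵥ u) ≤ ε * l2norm u) (g a : Fin N → ℂ) :
    l2norm a ≤ 4 * l2norm (collisionMatrix μ v g *ᵥ a) := by
  rw [collisionMatrix_mulVec]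
  set w := g * a with hw
  set e := interactionMatrix μ v *ᵥ w
  set y := star g * (w + e) with hy
  set e₂ := interactionMatrix μ (-v) *ᵥ y
  refine norm_le_of_accretive (a := WithLp.toLp 2 a) (w := WithLp.toLp 2 w) (e := WithLp.toLp 2 e)
    (y := WithLp.toLp 2 y) (e₂ := WithLp.toLp 2 e₂) ?_ ?_ ?_ rfl
  -- Multiplication by `star g` is the adjoint of multiplication by `g`, which gives ⟨y, a⟩ = ⟨w +
  -- e, w⟩.
  · simp only [PiLp.inner_apply, PiLp.add_apply, RCLike.inner_apply]
    refine Finset.sum_congr rfl fun k _ => ?_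
    simp [hy, hw]
    ring
  · exact (h1 w).trans (mul_le_mul_of_nonneg_right hε (l2norm_nonneg w))
  · exact (h2 y).trans (mul_le_mul_of_nonneg_right hε (l2norm_nonneg y))

/-- The stability bound makes the kernel trivial. It does not depend on g, so the system is solvable
at every (x, t), however large the weights are there. -/
theorem isUnit_collisionMatrix {μ : ℝ} {v : Fin N → ℝ} {ε : ℝ} (hε : ε ≤ 1 / 2)
    (h1 : ∀ u, l2norm (interactionMatrix μ v *ᵥ u) ≤ ε * l2norm u)
    (h2 : ∀ u, l2norm (interactionMatrix μ (-v) *ᵥ u) ≤ ε * l2norm u) (g : Fin N → ℂ) :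
    IsUnit (collisionMatrix μ v g) := by
  rw [← Matrix.mulVec_injective_iff_isUnit]
  intro a a' h
  have h3 := l2norm_le_collisionMatrix hε h1 h2 g (a - a')
  have h' : collisionMatrix μ v g *ᵥ a = collisionMatrix μ v g *ᵥ a' := h
  have h0 : l2norm (0 : Fin N → ℂ) = 0 := norm_zero
  rw [mulVec_sub, h', sub_self, h0, mul_zero] at h3
  have h4 : WithLp.toLp 2 (a - a') = 0 := norm_le_zero_iff.1 h3
  have h5 : a - a' = 0 := congrArg WithLp.ofLp h4
  exact sub_eq_zero.1 h5

theorem l2norm_le_sqrt_mul {u : Fin N → ℂ} {c : ℝ} (hc : 0 ≤ c) (h : ∀ k, ‖u k‖ ≤ c) :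
    l2norm u ≤ c * √N := by
  have h1 : l2norm u ≤ c * l2norm (1 : Fin N → ℂ) := l2norm_mono hc (by simpa using h)
  have h2 : l2norm (1 : Fin N → ℂ) = √N := by
    rw [← Real.sqrt_sq (l2norm_nonneg 1), l2norm_sq]
    simp
  rwa [h2] at h1

theorem norm_sum_mul_le {g e : Fin N → ℂ} {c : ℝ} (hc : 0 ≤ c) (h : ∀ k, ‖g k‖ ≤ c) :
    ‖∑ k, g k * e k‖ ≤ c * √N * l2norm e := by
  have h1 : ‖∑ k, g k * e k‖ ≤ c * ∑ k, ‖e k‖ := by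
    rw [Finset.mul_sum]
    refine (norm_sum_le _ _).trans (Finset.sum_le_sum fun k _ => ?_)
    rw [norm_mul]
    exact mul_le_mul_of_nonneg_right (h k) (norm_nonneg _)
  have h2 : ∑ k, ‖e k‖ ≤ √N * l2norm e := by
    refine le_of_sq_le_sq ?_ (mul_nonneg (Real.sqrt_nonneg _) (l2norm_nonneg e))
    rw [mul_pow, Real.sq_sqrt (Nat.cast_nonneg N), l2norm_sq]
    simpa using sq_sum_le_card_mul_sum_sq (s := (Finset.univ : Finset (Fin N))) (f := fun k => ‖e k‖)
  calc _ ≤ c * (√N * l2norm e) := h1.trans (by gcongr)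
    _ = _ := by ring

/-- The solution of the residue system is close to `1 / 2` when the coefficients `g` are close to
unimodular and the interaction is weak. -/
theorem norm_sum_sub_half_le {μ : ℝ} {v : Fin N → ℝ} {ε δ m : ℝ} (hε0 : 0 ≤ ε) (hε : ε ≤ 1 / 2)
    (hδ : 0 ≤ δ) (hm : 0 ≤ m)
    (h1 : ∀ u, l2norm (interactionMatrix μ v *ᵥ u) ≤ ε * l2norm u)
    (h2 : ∀ u, l2norm (interactionMatrix μ (-v) *ᵥ u) ≤ ε * l2norm u) {g a : Fin N → ℂ}
    (hg : ∀ k, ‖g k‖ ≤ m) (hg1 : ∀ k, |‖g k‖ ^ 2 - 1| ≤ δ)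
    (ha : collisionMatrix μ v g *ᵥ a = 1) :
    ‖∑ k, g k * a k - 1 / 2 * ∑ k, g k‖ ≤ 2 * m * N * (δ + 3 * m ^ 2 * ε) := by
  have hsqrt := Real.sqrt_nonneg (N : ℝ)
  set y := star g * (g + interactionMatrix μ v *ᵥ g) with hy
  have hEg : l2norm (interactionMatrix μ v *ᵥ g) ≤ ε * (m * √N) :=
    (h1 g).trans (by gcongr; exact l2norm_le_sqrt_mul hm hg)
  have hgg : ∀ u : Fin N → ℂ, l2norm (star g * u) ≤ m * l2norm u := fun u =>
    l2norm_mono hm fun k => by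
      rw [Pi.mul_apply, norm_mul, Pi.star_apply, norm_star]
      exact mul_le_mul_of_nonneg_right (hg k) (norm_nonneg _)
  have hyn : l2norm y ≤ m * (2 * (m * √N)) := by
    refine (hgg _).trans ?_
    gcongr
    refine (l2norm_add_le _ _).trans ?_
    have := l2norm_le_sqrt_mul hm hg
    nlinarith [mul_nonneg hm hsqrt]
  set e := a - fun _ => (1 / 2 : ℂ) with he
  -- The defect of the constant vector 1/2: it vanishes when |g_k| = 1 and E = 0.
  have hres : collisionMatrix μ v g *ᵥ e = (-(1 / 2) : ℂ) •
      ((star g * g - 1) + star g * (interactionMatrix μ v *ᵥ g) + interactionMatrix μ (-v) *ᵥ y) := by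
    have hhalf : (fun _ => (1 / 2 : ℂ) : Fin N → ℂ) = (1 / 2 : ℂ) • (1 : Fin N → ℂ) := by
      ext; simp
    rw [he, mulVec_sub, ha, hhalf, mulVec_smul, collisionMatrix_mulVec, mul_one, ← hy]
    ext k
    simp [hy]
    ring
  have hd : l2norm (star g * g - 1) ≤ δ * √N := l2norm_le_sqrt_mul hδ fun k => by
    have : (star g * g - 1) k = ((‖g k‖ ^ 2 - 1 : ℝ) : ℂ) := by
      simp only [Pi.sub_apply, Pi.mul_apply, Pi.star_apply, RCLike.star_def, Pi.one_apply]
      rw [mul_comm, mul_conj, normSq_eq_norm_sq]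
      push_cast; ring
    rw [this, Complex.norm_real, Real.norm_eq_abs]
    exact hg1 k
  have hen : l2norm e ≤ 2 * (√N * (δ + 3 * m ^ 2 * ε)) := by
    refine (l2norm_le_collisionMatrix hε h1 h2 g e).trans ?_
    rw [hres, l2norm_smul]
    have hhalf : ‖(-(1 / 2) : ℂ)‖ = 1 / 2 := by simp
    rw [hhalf]
    have hA := l2norm_add_le ((star g * g - 1) + star g * (interactionMatrix μ v *ᵥ g))
      (interactionMatrix μ (-v) *ᵥ y)
    have hB := l2norm_add_le (star g * g - 1) (star g * (interactionMatrix μ v *ᵥ g))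
    have hC := (hgg (interactionMatrix μ v *ᵥ g)).trans (mul_le_mul_of_nonneg_left hEg hm)
    have hD := (h2 y).trans (mul_le_mul_of_nonneg_left hyn hε0)
    nlinarith
  have hsum : ∑ k, g k * a k - 1 / 2 * ∑ k, g k = ∑ k, g k * e k := by
    simp only [he, Pi.sub_apply, mul_sub, Finset.sum_sub_distrib, ← Finset.sum_mul]
    ring
  rw [hsum]
  -- Cauchy–Schwarz supplies a second √N, so the error in the sum is N times a small quantity, as
  -- the normalization 1/N of ψ requires.
  calc _ ≤ m * √N * l2norm e := norm_sum_mul_le hm hg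
    _ ≤ m * √N * (2 * (√N * (δ + 3 * m ^ 2 * ε))) := by gcongr
    _ = 2 * m * (√N * √N) * (δ + 3 * m ^ 2 * ε) := by ring
    _ = _ := by rw [Real.mul_self_sqrt (Nat.cast_nonneg N)]

end Interaction

/-! ### Inverse-square sums over separated velocities. -/

section Separation

/-- The bound telescopes through 1/(m + 1)² ≤ 1/m - 1/(m + 1); at m = 0 it reads 0 ≤ 2, since `0⁻¹ =
0`. -/
theorem sum_inv_sq_le_two (m : ℕ) : ∑ i ∈ Finset.range m, (((i : ℝ) + 1)⁻¹) ^ 2 ≤ 2 - (m : ℝ)⁻¹ := by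
  induction m with
  | zero => simp
  | succ m ih =>
    rw [Finset.sum_range_succ]
    rcases Nat.eq_zero_or_pos m with rfl | hm
    · norm_num
    · have hm' : (0 : ℝ) < m := Nat.cast_pos.2 hm
      have : ((m : ℝ) + 1)⁻¹ ^ 2 ≤ (m : ℝ)⁻¹ - ((m : ℝ) + 1)⁻¹ := by
        rw [inv_sub_inv hm'.ne' (by positivity), inv_pow, inv_eq_one_div]
        have : (m : ℝ) + 1 - m = 1 := by ring
        rw [this]
        gcongr
        nlinarith
      push_cast
      linarith

theorem sum_inv_sub_sq_le (N k : ℕ) :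
    ∑ l ∈ Finset.range N, (((k : ℝ) - l)⁻¹) ^ 2 ≤ 4 := by
  have h2 : ∀ m, ∑ i ∈ Finset.range m, (((i : ℝ) + 1)⁻¹) ^ 2 ≤ 2 := fun m =>
    (sum_inv_sq_le_two m).trans (by have : (0 : ℝ) ≤ (m : ℝ)⁻¹ := by positivity
                                    linarith)
  calc ∑ l ∈ Finset.range N, (((k : ℝ) - l)⁻¹) ^ 2
      -- Enlarging the range avoids comparing k with N; it then splits into l < k, the vanishing
      -- term l = k, and l > k, with each side at most 2.
      ≤ ∑ l ∈ Finset.range (k + 1 + N), (((k : ℝ) - l)⁻¹) ^ 2 :=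
        Finset.sum_le_sum_of_subset_of_nonneg (Finset.range_subset_range.2 (by omega))
          fun _ _ _ => sq_nonneg _
    _ = ∑ l ∈ Finset.range k, (((k : ℝ) - l)⁻¹) ^ 2
        + ∑ i ∈ Finset.range N, (((i : ℝ) + 1)⁻¹) ^ 2 := by
      rw [Finset.sum_range_add, Finset.sum_range_succ]
      congr 1
      · simp
      · refine Finset.sum_congr rfl fun i _ => ?_
        have : (k : ℝ) - ((k + 1 + i : ℕ) : ℝ) = -((i : ℝ) + 1) := by push_cast; ring
        rw [this, inv_neg, neg_sq]
    _ = ∑ i ∈ Finset.range k, (((i : ℝ) + 1)⁻¹) ^ 2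
        + ∑ i ∈ Finset.range N, (((i : ℝ) + 1)⁻¹) ^ 2 := by
      congr 1
      rw [← Finset.sum_range_reflect]
      refine Finset.sum_congr rfl fun i hi => ?_
      have hi' := Finset.mem_range.1 hi
      rw [Nat.sub_sub, Nat.cast_sub (by omega)]
      push_cast
      congr 2; ring
    _ ≤ 4 := by linarith [h2 k, h2 N]

variable {N : ℕ} {v : Fin N → ℝ} {Δ : ℝ}

theorem mul_le_sub_of_separated (hmono : ∀ j k, j < k → v j + Δ ≤ v k) :
    ∀ (n : ℕ) (j k : Fin N), (k : ℕ) = j + n → v j + n * Δ ≤ v k := by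
  intro n
  induction n with
  | zero =>
    intro j k h
    have : j = k := Fin.ext (by simpa using h.symm)
    simp [this]
  | succ n ih =>
    intro j k h
    have h1 := ih j ⟨j + n, by have := k.2; omega⟩ rfl
    have h2 := hmono ⟨j + n, by have := k.2; omega⟩ k (Fin.lt_def.2 (by simp; omega))
    push_cast
    linarith

theorem sum_inv_sub_sq_le_of_separated (hΔ : 0 < Δ) (hmono : ∀ j k, j < k → v j + Δ ≤ v k)
    (k : Fin N) : ∑ l, ((v k - v l)⁻¹) ^ 2 ≤ 4 / Δ ^ 2 := by
  have key : ∀ l : Fin N, ((v k - v l)⁻¹) ^ 2 ≤ 1 / Δ ^ 2 * ((((k : ℕ) : ℝ) - (l : ℕ))⁻¹) ^ 2 := by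
    intro l
    have hsep : ∀ i j : Fin N, i < j →
        ((v j - v i)⁻¹) ^ 2 ≤ 1 / Δ ^ 2 * ((((j : ℕ) : ℝ) - (i : ℕ))⁻¹) ^ 2 := by
      intro i j hij
      have hij' : (i : ℕ) < j := hij
      have h1 := mul_le_sub_of_separated hmono (j - i : ℕ) i j (by omega)
      rw [Nat.cast_sub hij'.le] at h1
      have h2 : (0 : ℝ) < ((j : ℕ) : ℝ) - (i : ℕ) := sub_pos.2 (Nat.cast_lt.2 hij')
      have h3 : (1 : ℝ) / Δ ^ 2 * ((((j : ℕ) : ℝ) - (i : ℕ))⁻¹) ^ 2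
          = (((((j : ℕ) : ℝ) - (i : ℕ)) * Δ)⁻¹) ^ 2 := by
        rw [mul_inv]; ring
      have h4 := mul_pos h2 hΔ
      have h5 : 0 ≤ (v j - v i)⁻¹ := inv_nonneg.2 (by linarith)
      rw [h3]
      gcongr
      linarith
    rcases lt_trichotomy l k with h | h | h
    · exact hsep l k h
    · simp [h]
    · have := hsep k l h
      rwa [← neg_sub (v k), ← neg_sub ((k : ℕ) : ℝ), inv_neg, inv_neg, neg_sq, neg_sq] at this
  calc _ ≤ ∑ l : Fin N, 1 / Δ ^ 2 * ((((k : ℕ) : ℝ) - (l : ℕ))⁻¹) ^ 2 :=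
        Finset.sum_le_sum fun l _ => key l
    _ = 1 / Δ ^ 2 * ∑ l ∈ Finset.range N, ((((k : ℕ) : ℝ) - l)⁻¹) ^ 2 := by
      rw [← Finset.mul_sum, Finset.sum_range]
    _ ≤ 1 / Δ ^ 2 * 4 := by gcongr; exact sum_inv_sub_sq_le N k
    _ = _ := by ring

theorem injective_of_separated (hΔ : 0 < Δ) (hmono : ∀ j k, j < k → v j + Δ ≤ v k) :
    Function.Injective v :=
  StrictMono.injective fun j k hjk => by linarith [hmono j k hjk]

theorem interactionMatrix_bound_of_separated {μ : ℝ} (hμ : 0 < μ) (hΔ : 100 * μ < Δ)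
    (hmono : ∀ j k, j < k → v j + Δ ≤ v k) :
    (∀ u, l2norm (Matrix.mulVec (interactionMatrix μ v) u) ≤ 10 * μ / Δ * l2norm u) ∧
      ∀ u, l2norm (Matrix.mulVec (interactionMatrix μ (-v)) u) ≤ 10 * μ / Δ * l2norm u := by
  have hΔ0 : 0 < Δ := by linarith
  have hinj := injective_of_separated hΔ0 hmono
  have hsum := sum_inv_sub_sq_le_of_separated hΔ0 hmono
  refine ⟨interactionMatrix_bound hinj hμ hΔ hsum,
    interactionMatrix_bound (neg_injective.comp hinj) hμ hΔ fun k => ?_⟩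
  refine le_of_eq_of_le (Finset.sum_congr rfl fun l _ => ?_) (hsum k)
  have e : (-v) k - (-v) l = -(v k - v l) := by simp only [Pi.neg_apply]; ring
  rw [e, inv_neg, neg_sq]

end Separation

/-! ### Riemann sums and the Fresnel profile. -/

section Profile

theorem norm_riemann_sum_sub_integral_le {f : ℝ → ℂ} (hf : Continuous f) {L : ℝ}
    (hL : ∀ s ∈ Set.Icc (0 : ℝ) 1, ∀ r ∈ Set.Icc (0 : ℝ) 1, ‖f s - f r‖ ≤ L * |s - r|)
    (hL0 : 0 ≤ L) {N : ℕ} (hN : 0 < N) {s : Fin N → ℝ}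
    (hs : ∀ k : Fin N, s k ∈ Set.Icc (((k : ℕ) : ℝ) / N) ((((k : ℕ) : ℝ) + 1) / N)) :
    ‖(1 / (N : ℂ)) * ∑ k, f (s k) - ∫ x in (0 : ℝ)..1, f x‖ ≤ L / N := by
  have hN' : (0 : ℝ) < N := Nat.cast_pos.2 hN
  have hNc : (N : ℂ) ≠ 0 := Nat.cast_ne_zero.2 hN.ne'
  have hint : ∑ k : Fin N, ∫ x in (((k : ℕ) : ℝ) / N)..((((k : ℕ) : ℝ) + 1) / N), f x
      = ∫ x in (0 : ℝ)..1, f x := by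
    have h := intervalIntegral.sum_integral_adjacent_intervals (f := f)
      (μ := MeasureTheory.volume) (a := fun k : ℕ => (k : ℝ) / N) (n := N)
      (fun k _ => hf.intervalIntegrable _ _)
    rw [Finset.sum_range] at h
    simpa [hN'.ne'] using h
  have hk : ∀ k : Fin N, ‖(1 / (N : ℂ)) * f (s k)
      - ∫ x in (((k : ℕ) : ℝ) / N)..((((k : ℕ) : ℝ) + 1) / N), f x‖ ≤ L / N * (1 / N) := by
    intro k
    have hk1 : ((k : ℕ) : ℝ) + 1 ≤ N := by exact_mod_cast k.2
    have hle : ((k : ℕ) : ℝ) / N ≤ (((k : ℕ) : ℝ) + 1) / N := by gcongr; linarith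
    have hlen : (((k : ℕ) : ℝ) + 1) / N - ((k : ℕ) : ℝ) / N = 1 / N := by ring
    have h0 : 0 ≤ ((k : ℕ) : ℝ) / N := by positivity
    have h1 : (((k : ℕ) : ℝ) + 1) / N ≤ 1 := (div_le_one hN').2 hk1
    have hc : (1 / (N : ℂ)) * f (s k)
        = ∫ _ in (((k : ℕ) : ℝ) / N)..((((k : ℕ) : ℝ) + 1) / N), f (s k) := by
      rw [intervalIntegral.integral_const, hlen, real_smul]
      push_cast; rfl
    rw [hc, ← intervalIntegral.integral_sub intervalIntegrable_const (hf.intervalIntegrable _ _)]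
    refine (intervalIntegral.norm_integral_le_of_norm_le_const (C := L / N) fun x hx => ?_).trans ?_
    · rw [Set.uIoc_of_le hle] at hx
      refine (hL _ ⟨h0.trans (hs k).1, (hs k).2.trans h1⟩ _
        ⟨h0.trans hx.1.le, hx.2.trans h1⟩).trans ?_
      rw [div_eq_mul_one_div]
      gcongr
      rw [abs_le]
      constructor <;> linarith [(hs k).1, (hs k).2, hx.1, hx.2]
    · rw [hlen, abs_of_nonneg (by positivity)]
  rw [← hint, Finset.mul_sum, ← Finset.sum_sub_distrib]
  refine (norm_sum_le _ _).trans ((Finset.sum_le_sum fun k _ => hk k).trans ?_)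
  rw [Finset.sum_const, Finset.card_univ, Fintype.card_fin, nsmul_eq_mul]
  field_simp
  exact le_rfl

theorem norm_exp_I_mul_sub_exp_I_mul_le (a b : ℝ) :
    ‖exp (I * (a : ℂ)) - exp (I * (b : ℂ))‖ ≤ |a - b| := by
  have h : exp (I * (a : ℂ)) - exp (I * (b : ℂ))
      = exp (I * (b : ℂ)) * (exp (I * ((a - b : ℝ) : ℂ)) - 1) := by
    rw [mul_sub, ← exp_add, mul_one]
    congr 2
    push_cast; ring
  have h1 : ‖exp (I * (b : ℂ))‖ = 1 := by rw [mul_comm]; exact norm_exp_ofReal_mul_I b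
  rw [h, norm_mul, h1, one_mul]
  exact Real.norm_exp_I_mul_ofReal_sub_one_le

theorem norm_exp_sub_one_le_mul_exp {w : ℂ} {d : ℝ} (h : ‖w‖ ≤ d) :
    ‖exp w - 1‖ ≤ d * Real.exp d := by
  have h1 := norm_exp_sub_sum_le_norm_mul_exp w 1
  simp only [Finset.range_one, Finset.sum_singleton, pow_zero, Nat.factorial_zero, Nat.cast_one,
    div_one, pow_one] at h1
  have hd := (norm_nonneg w).trans h
  exact h1.trans (by gcongr)

theorem fresnelProfile_zero (X : ℝ) :
    fresnelProfile X 0 = -(exp (I * (X : ℂ)) * (Real.sinc X : ℂ)) := by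
  unfold fresnelProfile
  congr 1
  rcases eq_or_ne X 0 with rfl | hX
  · simp
  · have hXc : (X : ℂ) ≠ 0 := ofReal_ne_zero.2 hX
    have hc : 2 * I * (X : ℂ) ≠ 0 := mul_ne_zero (mul_ne_zero two_ne_zero I_ne_zero) hXc
    have h := integral_exp_mul_complex (a := 0) (b := 1) hc
    have e : ∀ s : ℝ, exp (I * ((2 * X * s - 0 / 2 * s ^ 2 : ℝ) : ℂ)) = exp (2 * I * X * s) := by
      intro s
      congr 1
      push_cast; ring
    simp_rw [e]
    rw [h, Real.sinc_of_ne_zero hX]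
    push_cast
    rw [Complex.sin]
    have e1 : exp (2 * I * X * 1) = exp (I * X) * exp (X * I) := by
      rw [← exp_add]; congr 1; ring
    have e2 : exp (2 * I * X * 0) = exp (I * X) * exp (-X * I) := by
      rw [← exp_add]; congr 1; ring
    rw [e1, e2]
    have hI := I_ne_zero
    field_simp
    ring_nf
    simp [sub_eq_add_neg]

/-- Substituting s = α + r gives 2Xs - Ts²/2 = (2αX - α²T/2) + 2(X - αT/2)r - Tr²/2: the constant is
the phase prefactor and the rest is the profile's phase at the shifted position. The plus sign
reflects the minus sign in `fresnelProfile`. -/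
theorem norm_average_sub_fresnelProfile_le {α R X T : ℝ} (hX : |X| ≤ R) (hT : |T| ≤ R) {N : ℕ}
    (hN : 0 < N) {s : Fin N → ℝ}
    (hs : ∀ k : Fin N, s k ∈ Set.Icc (α + ((k : ℕ) : ℝ) / N) (α + (((k : ℕ) : ℝ) + 1) / N)) :
    ‖(1 / (N : ℂ)) * ∑ k, exp (I * ((2 * X * s k - T / 2 * s k ^ 2 : ℝ) : ℂ))
      + exp (I * ((2 * α * X - α ^ 2 * (T / 2) : ℝ) : ℂ)) * fresnelProfile (X - α * T / 2) T‖
      ≤ R * (4 + |α|) / N := by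
  set f : ℝ → ℂ := fun r => exp (I * ((2 * (X - α * T / 2) * r - T / 2 * r ^ 2 : ℝ) : ℂ)) with hf
  have hR : 0 ≤ R := (abs_nonneg X).trans hX
  have hα := abs_nonneg α
  have hX' : |X - α * T / 2| ≤ R + |α| * R / 2 := by
    have h1 : |α * T / 2| ≤ |α| * R / 2 := by
      rw [abs_div, abs_mul, abs_two]; gcongr
    exact (abs_sub _ _).trans (add_le_add hX h1)
  have h := norm_riemann_sum_sub_integral_le (f := f) (L := R * (4 + |α|)) (by fun_prop) ?_
    (by positivity) hN (s := fun k => s k - α) fun k =>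
      ⟨by linarith [(hs k).1], by linarith [(hs k).2]⟩
  · have hphase : ∀ k, exp (I * ((2 * X * s k - T / 2 * s k ^ 2 : ℝ) : ℂ))
        = exp (I * ((2 * α * X - α ^ 2 * (T / 2) : ℝ) : ℂ)) * f (s k - α) := by
      intro k
      rw [hf, ← exp_add]
      congr 1
      push_cast; ring
    have hE : ‖exp (I * ((2 * α * X - α ^ 2 * (T / 2) : ℝ) : ℂ))‖ = 1 := by
      rw [mul_comm]; exact norm_exp_ofReal_mul_I _
    simp_rw [hphase, ← Finset.mul_sum]
    have e : (1 / (N : ℂ)) * (exp (I * ((2 * α * X - α ^ 2 * (T / 2) : ℝ) : ℂ))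
        * ∑ k, f (s k - α)) + exp (I * ((2 * α * X - α ^ 2 * (T / 2) : ℝ) : ℂ))
          * fresnelProfile (X - α * T / 2) T
        = exp (I * ((2 * α * X - α ^ 2 * (T / 2) : ℝ) : ℂ)) *
          ((1 / (N : ℂ)) * ∑ k, f (s k - α) - ∫ x in (0 : ℝ)..1, f x) := by
      rw [fresnelProfile]; ring
    rw [e, norm_mul, hE, one_mul]
    exact h
  · intro p hp r hr
    refine (norm_exp_I_mul_sub_exp_I_mul_le _ _).trans ?_
    have e : 2 * (X - α * T / 2) * p - T / 2 * p ^ 2 - (2 * (X - α * T / 2) * r - T / 2 * r ^ 2)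
        = (2 * (X - α * T / 2) - T / 2 * (p + r)) * (p - r) := by ring
    rw [e, abs_mul]
    gcongr
    have h1 : |T / 2 * (p + r)| ≤ R / 2 * 2 := by
      rw [abs_mul, abs_div, abs_two]
      gcongr
      rw [abs_of_nonneg (add_nonneg hp.1 hr.1)]
      linarith [hp.2, hr.2]
    have h2 : |2 * (X - α * T / 2)| ≤ 2 * (R + |α| * R / 2) := by
      rw [abs_mul, abs_two]; gcongr
    refine (abs_sub _ _).trans ((add_le_add h2 h1).trans ?_)
    nlinarith

end Profile

/-! ### Residue coefficients near the collision point. -/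

section Coefficients

/-- For q = 1/(NV) this splits the weight into a unimodular phase at s = vq and a correction whose
exponent carries the small factor μq. -/
theorem conj_collisionCoeff_mul_exp (μ v q X T : ℝ) :
    conj (collisionCoeff μ v *
        exp (2 * I * nlsPhase (solitonPole μ v) (2 * X * q) (1 + T * q ^ 2)))
      = μ * (-I * exp (I * ((2 * X * (v * q) - T / 2 * (v * q) ^ 2 : ℝ) : ℂ))
        * exp (μ * q * (-2 * X + T * (v * q) + I * (T * (μ * q) / 2)))) := by
  have h2 : conj (2 : ℂ) = 2 := map_ofNat _ 2
  rw [collisionCoeff]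
  simp only [map_mul, ← exp_conj, conj_ofReal, conj_I, nlsPhase, solitonPole, map_div₀, map_add,
    map_neg, map_pow, h2]
  have e : ∀ A B C D : ℂ, A + B = C + D → -I * μ * exp A * exp B
      = μ * (-I * exp C * exp D) := by
    intro A B C D h
    rw [mul_assoc, ← exp_add, h, exp_add]; ring
  refine e _ _ _ _ ?_
  push_cast
  linear_combination (2 * μ * X * q - v * μ * q ^ 2 * T - 1 / 2 * I * μ ^ 2 * q ^ 2 * T) * I_sq

end Coefficients

/-! ### The soliton solution and its asymptotics. -/

section Soliton

open Matrix

variable {N : ℕ}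

/-- The normalized conjugate residue coefficients of the collision problem at `(x, t)`. -/
noncomputable def collisionWeight (μ : ℝ) (v : Fin N → ℝ) (x t : ℝ) (k : Fin N) : ℂ :=
  conj (collisionCoeff μ (v k) * exp (2 * I * nlsPhase (solitonPole μ (v k)) x t)) / μ

/-- The collision solution, through the inverse of the matrix of the residue system. -/
noncomputable def collisionSolution (μ : ℝ) (v : Fin N → ℝ) (x t : ℝ) : ℂ :=
  -2 * I * μ * ∑ k, collisionWeight μ v x t k *
    ((collisionMatrix μ v (collisionWeight μ v x t))⁻¹ *ᵥ 1) k

theorem conj_eq_mul_collisionWeight {μ : ℝ} (hμ : μ ≠ 0) (v : Fin N → ℝ) (x t : ℝ) (k : Fin N) :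
    conj (collisionCoeff μ (v k) * exp (2 * I * nlsPhase (solitonPole μ (v k)) x t))
      = μ * collisionWeight μ v x t k := by
  rw [collisionWeight, mul_div_cancel₀ _ (ofReal_ne_zero.2 hμ)]

theorem solitonPole_ne_conj {μ : ℝ} (hμ : μ ≠ 0) (v w : ℝ) :
    solitonPole μ v ≠ conj (solitonPole μ w) := by
  intro h
  have h1 := solitonPole_sub_conj μ v w
  rw [sub_eq_zero.2 h] at h1
  exact div_ne_zero (sub_add_two_I_mul_ne_zero hμ (w - v)) two_ne_zero h1.symm

theorem solitonPole_injective {μ : ℝ} {v : Fin N → ℝ} (hv : Function.Injective v) :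
    Function.Injective fun k => solitonPole μ (v k) := by
  intro j k h
  refine hv ?_
  have h1 := congrArg Complex.re h
  simpa [solitonPole] using h1

theorem collisionCoeff_ne_zero {μ : ℝ} (hμ : μ ≠ 0) (v : ℝ) : collisionCoeff μ v ≠ 0 :=
  mul_ne_zero (mul_ne_zero I_ne_zero (ofReal_ne_zero.2 hμ)) (exp_ne_zero _)

theorem isNSolitonSolution_collisionSolution {μ : ℝ} (hμ : μ ≠ 0) {v : Fin N → ℝ}
    (hv : Function.Injective v) (hunit : ∀ g, IsUnit (collisionMatrix μ v g)) :
    IsNSolitonSolution (fun k => solitonPole μ (v k)) (fun k => collisionCoeff μ (v k))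
      (collisionSolution μ v) := by
  intro x t
  set g := collisionWeight μ v x t with hg
  set a : Fin N → ℂ := (collisionMatrix μ v g)⁻¹ *ᵥ 1 with ha
  have hconj := conj_eq_mul_collisionWeight hμ v x t
  have hsol := (isResidueSystemSolution_iff hμ v g _ hconj a _).2 ⟨by
    rw [ha, mulVec_mulVec, mul_nonsing_inv _ ((isUnit_iff_isUnit_det _).1 (hunit g)), one_mulVec],
    rfl⟩
  refine ⟨_, solvesSolitonRHP_residueMatrix (solitonPole_injective hv)
    (fun j k => solitonPole_ne_conj hμ _ _) hsol, ?_⟩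
  have hlim := residueMatrix_tendsto (fun k => solitonPole μ (v k)) (fun k => collisionCoeff μ (v k)
    * exp (2 * I * nlsPhase (solitonPole μ (v k)) x t)) a
    (I • (g * a + interactionMatrix μ v *ᵥ (g * a)))
  have e : -2 * I * ∑ k, conj (collisionCoeff μ (v k) *
      exp (2 * I * nlsPhase (solitonPole μ (v k)) x t)) * a k = collisionSolution μ v x t := by
    rw [collisionSolution, ← hg, ← ha]
    simp_rw [hconj, mul_assoc, ← Finset.mul_sum]
    rfl
  rwa [e] at hlim

theorem IsNSolitonSolution.eq_collisionSolution {μ : ℝ} (hμ : μ ≠ 0) {v : Fin N → ℝ}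
    (hv : Function.Injective v) (hunit : ∀ g, IsUnit (collisionMatrix μ v g)) {φ : ℝ → ℝ → ℂ}
    (hφ : IsNSolitonSolution (fun k => solitonPole μ (v k)) (fun k => collisionCoeff μ (v k)) φ) :
    φ = collisionSolution μ v := by
  funext x t
  obtain ⟨M, hM, hlim⟩ := hφ x t
  obtain ⟨a, b, hab, hlim'⟩ := hM.exists_residueSystemSolution (solitonPole_injective hv)
    (fun j k => solitonPole_ne_conj hμ _ _) (fun k => collisionCoeff_ne_zero hμ _)
  have hconj := conj_eq_mul_collisionWeight hμ v x t
  have ha := ((isResidueSystemSolution_iff hμ v _ _ hconj a b).1 hab).1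
  have ha' : (collisionMatrix μ v (collisionWeight μ v x t))⁻¹ *ᵥ 1 = a := by
    rw [← ha, mulVec_mulVec, nonsing_inv_mul _ ((isUnit_iff_isUnit_det _).1 (hunit _)), one_mulVec]
  rw [tendsto_nhds_unique hlim hlim', collisionSolution, ha']
  simp_rw [hconj, mul_assoc, ← Finset.mul_sum]

/-- The asymptotics of the collision solution, for well separated velocities in the intervals
`[(α N + k) V, (α N + k + 1) V]`. -/
theorem norm_collisionSolution_sub_le {α μ R V Δ X T : ℝ} (hμ : 0 < μ) (hV : μ ≤ V)
    (hX : |X| ≤ R) (hT : |T| ≤ R) (hN : 0 < N) {v : Fin N → ℝ} (hΔ : 100 * μ < Δ)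
    (hmono : ∀ j k, j < k → v j + Δ ≤ v k)
    (hv : ∀ k : Fin N, v k ∈ Set.Icc ((α * N + (k : ℕ)) * V) ((α * N + (k : ℕ) + 1) * V)) :
    ‖(1 / (N : ℂ)) * collisionSolution μ v (2 * X / (N * V)) (1 + T / (N * V) ^ 2)
      - (μ : ℂ) * exp (I * ((2 * α * X - α ^ 2 * (T / 2) : ℝ) : ℂ))
        * fresnelProfile (X - α * T / 2) T‖
      ≤ μ * (R * (4 + |α|)) * (1 / N) + μ * (R * (4 + |α|)) * Real.exp (R * (4 + |α|)) * (1 / N)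
        + 4 * μ * Real.exp (R * (4 + |α|)) *
          (2 * (R * (4 + |α|)) * Real.exp (2 * (R * (4 + |α|))) * (1 / N)
            + 3 * Real.exp (R * (4 + |α|)) ^ 2 * (10 * μ) * (1 / Δ)) := by
  have hμ0 := hμ.ne'
  have hΔ0 : 0 < Δ := by linarith
  have hR : 0 ≤ R := (abs_nonneg X).trans hX
  have hα := abs_nonneg α
  set c := R * (4 + |α|) with hc
  have hc0 : 0 ≤ c := by positivity
  have hN1 : (1 : ℝ) ≤ N := by exact_mod_cast hN
  have hN0 : (0 : ℝ) < N := by linarith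
  have hV0 : 0 < V := hμ.trans_le hV
  obtain ⟨hE, hE'⟩ := interactionMatrix_bound_of_separated hμ hΔ hmono
  have hε : 10 * μ / Δ ≤ 1 / 2 := by rw [div_le_div_iff₀ hΔ0 two_pos]; linarith
  have hε0 : 0 ≤ 10 * μ / Δ := by positivity
  set q : ℝ := (N * V)⁻¹ with hq
  have hq0 : 0 < q := by positivity
  have hμq : μ * q ≤ 1 / N := by
    rw [hq, ← div_eq_mul_inv, div_le_div_iff₀ (by positivity) hN0]
    nlinarith
  set s : Fin N → ℝ := fun k => v k * q with hs
  have hNV : (N * V) * q = 1 := mul_inv_cancel₀ (by positivity)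
  have hVq : V * q = 1 / N := by field_simp; linarith
  have hsmem : ∀ k : Fin N, s k ∈ Set.Icc (α + ((k : ℕ) : ℝ) / N) (α + (((k : ℕ) : ℝ) + 1) / N) := by
    intro k
    have e1 : (α * N + (k : ℕ)) * V * q = α + ((k : ℕ) : ℝ) / N := by
      rw [mul_assoc, hVq]; field_simp
    have e2 : (α * N + (k : ℕ) + 1) * V * q = α + (((k : ℕ) : ℝ) + 1) / N := by
      rw [mul_assoc, hVq]; field_simp; ring
    rw [← e1, ← e2]
    exact ⟨mul_le_mul_of_nonneg_right (hv k).1 hq0.le, mul_le_mul_of_nonneg_right (hv k).2 hq0.le⟩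
  have hsabs : ∀ k, |s k| ≤ |α| + 1 := by
    intro k
    have h1 : (((k : ℕ) : ℝ) + 1) / N ≤ 1 := (div_le_one hN0).2 (by exact_mod_cast k.2)
    have h2 : 0 ≤ ((k : ℕ) : ℝ) / N := by positivity
    rw [abs_le]
    constructor
    · linarith [(hsmem k).1, neg_abs_le α]
    · linarith [(hsmem k).2, le_abs_self α]
  set x := 2 * X / (N * V) with hx
  set t := 1 + T / (N * V) ^ 2 with ht
  have hx' : x = 2 * X * q := by rw [hx, hq, div_eq_mul_inv]
  have ht' : t = 1 + T * q ^ 2 := by rw [ht, hq, div_eq_mul_inv, inv_pow]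
  set g := collisionWeight μ v x t with hg
  set h : Fin N → ℂ := fun k => exp (I * ((2 * X * s k - T / 2 * s k ^ 2 : ℝ) : ℂ)) with hh
  set d : Fin N → ℂ := fun k => μ * q * (-2 * X + T * (v k * q) + I * (T * (μ * q) / 2)) with hd
  have hgk : ∀ k, g k = -I * h k * exp (d k) := by
    intro k
    rw [hg, collisionWeight, hx', ht', conj_collisionCoeff_mul_exp,
      mul_div_cancel_left₀ _ (ofReal_ne_zero.2 hμ0)]
  have hhn : ∀ k, ‖h k‖ = 1 := fun k => by
    change ‖exp (I * _)‖ = 1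
    rw [mul_comm I]; exact norm_exp_ofReal_mul_I _
  have hdn : ∀ k, ‖d k‖ ≤ c * (1 / N) := by
    intro k
    have h1 : ‖(-2 * X + T * (v k * q) + I * (T * (μ * q) / 2) : ℂ)‖
        ≤ 2 * R + R * (|α| + 1) + R := by
      have n1 : ‖(-2 * X : ℂ)‖ ≤ 2 * R := by
        simpa using hX
      have n2 : ‖(T * (v k * q) : ℂ)‖ ≤ R * (|α| + 1) := by
        rw [← ofReal_mul, ← ofReal_mul, Complex.norm_real, Real.norm_eq_abs, abs_mul]
        exact mul_le_mul hT (hsabs k) (abs_nonneg _) hR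
      have n3 : ‖(I * (T * (μ * q) / 2) : ℂ)‖ ≤ R := by
        rw [norm_mul, norm_I, one_mul, norm_div, norm_mul, ← ofReal_mul, Complex.norm_real,
          Complex.norm_real, Real.norm_eq_abs, Real.norm_eq_abs, abs_of_pos (mul_pos hμ hq0)]
        have h2 : μ * q ≤ 1 := hμq.trans ((div_le_one hN0).2 hN1)
        have h3 : |T| * (μ * q) ≤ R * 1 := mul_le_mul hT h2 (by positivity) hR
        simp only [Complex.norm_ofNat]
        linarith
      refine (norm_add_le _ _).trans (add_le_add ((norm_add_le _ _).trans (add_le_add n1 n2)) n3)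
    have h2 : ‖(μ * q : ℂ)‖ ≤ 1 / N := by
      rw [← ofReal_mul, Complex.norm_real, Real.norm_eq_abs, abs_of_pos (mul_pos hμ hq0)]
      exact hμq
    rw [hd]
    simp only [norm_mul _ (-2 * X + T * (v k * q) + I * (T * (μ * q) / 2) : ℂ)]
    calc _ ≤ 1 / N * (2 * R + R * (|α| + 1) + R) := by gcongr
      _ = c * (1 / N) := by rw [hc]; ring
  have hcN : c * (1 / N) ≤ c := mul_le_of_le_one_right hc0 ((div_le_one hN0).2 hN1)
  have hgn : ∀ k, ‖g k‖ = Real.exp (d k).re := by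
    intro k
    rw [hgk, norm_mul, norm_mul, hhn, norm_exp]
    simp
  have hre : ∀ k, |(d k).re| ≤ c * (1 / N) := fun k => (abs_re_le_norm _).trans (hdn k)
  have hgm : ∀ k, ‖g k‖ ≤ Real.exp c := fun k => by
    rw [hgn]
    exact Real.exp_le_exp.2 ((le_abs_self _).trans ((hre k).trans hcN))
  have hgone : ∀ k, |‖g k‖ ^ 2 - 1| ≤ 2 * c * Real.exp (2 * c) * (1 / N) := by
    intro k
    have h1 : ‖((2 * (d k).re : ℝ) : ℂ)‖ ≤ 2 * (c * (1 / N)) := by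
      rw [Complex.norm_real, Real.norm_eq_abs, abs_mul, abs_two]
      gcongr
      exact hre k
    have h2 := norm_exp_sub_one_le_mul_exp h1
    have h3 : exp ((2 * (d k).re : ℝ) : ℂ) - 1 = ((‖g k‖ ^ 2 - 1 : ℝ) : ℂ) := by
      rw [hgn, ← Real.exp_nat_mul]
      push_cast; rfl
    rw [h3, Complex.norm_real, Real.norm_eq_abs] at h2
    refine h2.trans ?_
    calc 2 * (c * (1 / N)) * Real.exp (2 * (c * (1 / N)))
        ≤ 2 * (c * (1 / N)) * Real.exp (2 * c) := by gcongr
      _ = _ := by ring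
  set a : Fin N → ℂ := (collisionMatrix μ v g)⁻¹ *ᵥ 1 with ha
  have ha1 : collisionMatrix μ v g *ᵥ a = 1 := by
    rw [ha, mulVec_mulVec, mul_nonsing_inv _ ((isUnit_iff_isUnit_det _).1
      (isUnit_collisionMatrix hε hE hE' g)), one_mulVec]
  have hmain := norm_sum_sub_half_le hε0 hε (by positivity) (Real.exp_pos c).le hE hE' hgm hgone ha1
  have hgh : ‖∑ k, g k + I * ∑ k, h k‖ ≤ N * (c * (1 / N) * Real.exp c) := by
    rw [Finset.mul_sum, ← Finset.sum_add_distrib]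
    refine (norm_sum_le _ _).trans ?_
    have h1 : ∀ k ∈ Finset.univ, ‖g k + I * h k‖ ≤ c * (1 / N) * Real.exp c := by
      intro k _
      have e : g k + I * h k = -I * h k * (exp (d k) - 1) := by rw [hgk]; ring
      rw [e, norm_mul, norm_mul, hhn, norm_neg, norm_I, one_mul, one_mul]
      refine (norm_exp_sub_one_le_mul_exp (hdn k)).trans ?_
      gcongr
    refine (Finset.sum_le_sum h1).trans ?_
    simp
  have havg := norm_average_sub_fresnelProfile_le (α := α) hX hT hN hsmem
  set P : ℂ := exp (I * ((2 * α * X - α ^ 2 * (T / 2) : ℝ) : ℂ)) * fresnelProfile (X - α * T / 2) T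
    with hP
  -- Three errors: the Riemann sum, the replacement of g by -i h, and the replacement of a by 1/2.
  -- Only the last involves 1/Δ.
  have hdecomp : (1 / (N : ℂ)) * collisionSolution μ v x t
      - (μ : ℂ) * exp (I * ((2 * α * X - α ^ 2 * (T / 2) : ℝ) : ℂ))
        * fresnelProfile (X - α * T / 2) T
      = -μ * ((1 / (N : ℂ)) * ∑ k, h k + P)
        + (-I * μ * (1 / (N : ℂ))) * (∑ k, g k + I * ∑ k, h k)
        + (-2 * I * μ * (1 / (N : ℂ))) * (∑ k, g k * a k - 1 / 2 * ∑ k, g k) := by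
    rw [mul_assoc (μ : ℂ), ← hP, collisionSolution]
    linear_combination ((1 / (N : ℂ)) * μ * ∑ k, h k) * I_sq
  have hinvN : ‖(1 / (N : ℂ))‖ = 1 / N := by simp
  have hμn : ‖(μ : ℂ)‖ = μ := by rw [Complex.norm_real, Real.norm_eq_abs, abs_of_pos hμ]
  rw [hdecomp]
  refine (norm_add_le _ _).trans (add_le_add ((norm_add_le _ _).trans (add_le_add ?_ ?_)) ?_)
  · rw [norm_mul, norm_neg, hμn]
    calc _ ≤ μ * (c / N) := by gcongr
      _ = _ := by ring
  · simp only [norm_mul, norm_neg, norm_I, hμn, hinvN, one_mul]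
    calc _ ≤ μ * (1 / N) * (N * (c * (1 / N) * Real.exp c)) := by gcongr
      _ = _ := by field_simp
  · simp only [norm_mul _ (∑ k, g k * a k - 1 / 2 * ∑ k, g k)]
    have hn : ‖(-2 * I * μ * (1 / (N : ℂ)))‖ = 2 * μ * (1 / N) := by
      simp only [norm_mul, norm_neg, norm_I, hμn, hinvN, mul_one, Complex.norm_ofNat]
    rw [hn]
    calc _ ≤ 2 * μ * (1 / N) * (2 * Real.exp c * N * (2 * c * Real.exp (2 * c) * (1 / N)
          + 3 * Real.exp c ^ 2 * (10 * μ / Δ))) := by gcongr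
      _ = _ := by field_simp; ring

end Soliton

/-! ### The collision asymptotics. -/

theorem corollary1p3 :
    ∃ Cstar : ℝ, 0 < Cstar ∧ ∃ N₀ : ℕ, ∀ α μ : ℝ, 0 < μ → ∀ R : ℝ, ∃ K : ℝ,
      ∀ (N : ℕ) (V : ℝ) (v : Fin N → ℝ) (Δ : ℝ), N₀ ≤ N → 0 < V →
        (∀ k : Fin N, v k ∈ Set.Icc ((α * N + (k : ℕ)) * V) ((α * N + (k : ℕ) + 1) * V)) →
        IsLeast {d : ℝ | ∃ j k : Fin N, j ≠ k ∧ d = |v j - v k|} Δ →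
        Cstar * μ < Δ →
        ∃ ψ : ℝ → ℝ → ℂ,
          IsNSolitonSolution (fun k => solitonPole μ (v k)) (fun k => collisionCoeff μ (v k)) ψ ∧
          (∀ φ : ℝ → ℝ → ℂ, IsNSolitonSolution (fun k => solitonPole μ (v k))
            (fun k => collisionCoeff μ (v k)) φ → φ = ψ) ∧
          (∀ X T : ℝ, |X| ≤ R → |T| ≤ R →
            ‖(1 / (N : ℂ)) * ψ (2 * X / (N * V)) (1 + T / (N * V) ^ 2)
              - (μ : ℂ) * exp (I * ((2 * α * X - α ^ 2 * (T / 2) : ℝ) : ℂ))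
                * fresnelProfile (X - α * T / 2) T‖
              ≤ K * max (1 / (N : ℝ)) (1 / Δ)) ∧
          (∀ X : ℝ, |X| ≤ R →
            ‖(1 / (N : ℂ)) * ψ (2 * X / (N * V)) 1
              - (-(μ : ℂ) * exp (I * (((2 * α + 1) * X : ℝ) : ℂ)) * (Real.sinc X : ℂ))‖
              ≤ K * max (1 / (N : ℝ)) (1 / Δ)) := by
  -- The value 100 makes 10 μ/Δ ≤ 1/2 with room to spare. No lower bound on N is imposed: the
  -- existence of a minimal distance already forces N ≥ 2.
  refine ⟨100, by norm_num, 0, fun α μ hμ R => ?_⟩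
  set c := R * (4 + |α|) with hc
  refine ⟨μ * c + μ * c * Real.exp c + 4 * μ * Real.exp c *
    (2 * c * Real.exp (2 * c) + 3 * Real.exp c ^ 2 * (10 * μ)), ?_⟩
  intro N V v Δ _ hV hv hleast hΔ
  have hΔ0 : 0 < Δ := by linarith
  obtain ⟨⟨j₀, k₀, hjk₀, -⟩, hmin⟩ := hleast
  have hN2 : 2 ≤ N := by
    have h1 := j₀.2
    have h2 := k₀.2
    have h3 : (j₀ : ℕ) ≠ k₀ := fun e => hjk₀ (Fin.ext e)
    omega
  have hmono : ∀ j k, j < k → v j + Δ ≤ v k := by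
    intro j k hjk
    have h1 : Δ ≤ |v k - v j| := hmin ⟨k, j, hjk.ne', rfl⟩
    have h2 : ((j : ℕ) : ℝ) + 1 ≤ (k : ℕ) := by exact_mod_cast hjk
    have h3 : v j ≤ v k := by
      refine (hv j).2.trans (le_trans ?_ (hv k).1)
      gcongr ?_ * V
      linarith
    rw [abs_of_nonneg (sub_nonneg.2 h3)] at h1
    linarith
  have hinj := injective_of_separated hΔ0 hmono
  -- The first two velocities lie in an interval of length 2V, so 100 μ < Δ ≤ 2V.
  have hμV : μ ≤ V := by
    have h1 := hmono ⟨0, by omega⟩ ⟨1, by omega⟩ (Fin.lt_def.2 Nat.zero_lt_one)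
    have h2 := (hv ⟨0, by omega⟩).1
    have h3 := (hv ⟨1, by omega⟩).2
    simp only [Nat.cast_zero, Nat.cast_one] at h2 h3
    nlinarith
  have hunit : ∀ g, IsUnit (collisionMatrix μ v g) := by
    obtain ⟨hE, hE'⟩ := interactionMatrix_bound_of_separated hμ hΔ hmono
    exact isUnit_collisionMatrix (by rw [div_le_div_iff₀ hΔ0 two_pos]; linarith) hE hE'
  have hasymp : ∀ X T : ℝ, |X| ≤ R → |T| ≤ R →
      ‖(1 / (N : ℂ)) * collisionSolution μ v (2 * X / (N * V)) (1 + T / (N * V) ^ 2)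
        - (μ : ℂ) * exp (I * ((2 * α * X - α ^ 2 * (T / 2) : ℝ) : ℂ))
          * fresnelProfile (X - α * T / 2) T‖
        ≤ (μ * c + μ * c * Real.exp c + 4 * μ * Real.exp c *
          (2 * c * Real.exp (2 * c) + 3 * Real.exp c ^ 2 * (10 * μ)))
            * max (1 / (N : ℝ)) (1 / Δ) := by
    intro X T hX hT
    have hR : 0 ≤ R := (abs_nonneg X).trans hX
    have hc0 : 0 ≤ c := mul_nonneg hR (by positivity)
    refine (norm_collisionSolution_sub_le hμ hμV hX hT (by omega) hΔ hmono hv).trans ?_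
    rw [← hc]
    have hm1 := le_max_left (1 / (N : ℝ)) (1 / Δ)
    have hm2 := le_max_right (1 / (N : ℝ)) (1 / Δ)
    set m := max (1 / (N : ℝ)) (1 / Δ)
    calc _ ≤ μ * c * m + μ * c * Real.exp c * m + 4 * μ * Real.exp c *
          (2 * c * Real.exp (2 * c) * m + 3 * Real.exp c ^ 2 * (10 * μ) * m) := by gcongr
      _ = _ := by ring
  refine ⟨collisionSolution μ v, isNSolitonSolution_collisionSolution hμ.ne' hinj hunit,
    fun φ hφ => hφ.eq_collisionSolution hμ.ne' hinj hunit, hasymp, fun X hX => ?_⟩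
  have h := hasymp X 0 hX (by simpa using (abs_nonneg X).trans hX)
  have e : (μ : ℂ) * exp (I * ((2 * α * X - α ^ 2 * (0 / 2) : ℝ) : ℂ))
      * fresnelProfile (X - α * 0 / 2) 0
      = -(μ : ℂ) * exp (I * (((2 * α + 1) * X : ℝ) : ℂ)) * (Real.sinc X : ℂ) := by
    have e1 : X - α * 0 / 2 = X := by ring
    have e2 : exp (I * (((2 * α + 1) * X : ℝ) : ℂ))
        = exp (I * ((2 * α * X - α ^ 2 * (0 / 2) : ℝ) : ℂ)) * exp (I * (X : ℂ)) := by
      rw [← exp_add]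
      congr 1
      push_cast; ring
    rw [e1, fresnelProfile_zero, e2]
    ring
  rw [e, zero_div, add_zero] at h
  exact h
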